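/- For each $n\ge 1$ let $\mathcal L_n$ denote a law of $(X,Y,Z)\in\mathbb R\times\mathbb R\times\mathbb R^{p_n}$ and let $(X_i,Y_i,Z_i)$, $i=1,\dots,n$, be i.i.d. from $\mathcal L_n$. Write $\mu_{n,x}(Z)=\mathbb E_{\mathcal L_n}[X\mid Z]$, $\mu_{n,y}(Z)=\mathbb E_{\mathcal L_n}[Y\mid Z]$, and let $\mathcal L_n^0$ be the set of laws under which $X$ and $Y$ are conditionally independent given $Z$. Let $\widehat{\mathcal L}_n(X\mid Z)$ be a conditional law learned from $(X_i,Z_i)_{i\le n}$, with mean $\widehat\mu_{n,x}(Z)$ and variance $\mathrm{Var}_{\widehat{\mathcal L}_n}[X\mid Z]$, and let $\widehat\mu_{n,y}$ be a function learned from $(Y_i,Z_i)_{i\le n}$. Given the data, let $\widetilde X_i\sim\widehat{\mathcal L}_n(\cdot\mid Z_i)$ be independent, and for $x\in\mathbb R^n$ put $$T_n(x)=\frac1{\sqrt n}\sum_{i=1}^n (x_i-\widehat\mu_{n,x}(Z_i))(Y_i-\widehat\mu_{n,y}(Z_i)).$$ For $\alpha\in(0,1)$, the $\widehat{\mathrm{dCRT}}$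 (in its limit of infinitely many resamples) is the test $\phi_n=\mathbf 1\{T_n(X_1,\dots,X_n)>Q_n\}$, where $Q_n=\inf\{t:\mathbb P[T_n(\widetilde X)\le t\mid \text{data}]\ge 1-\alpha\}$. Let $\mathcal R_n$, $n\ge1$, be nonempty sets of laws under which the conditional variances of $X$ and of $Y$ given $Z$ are finite almost surely, and suppose that every sequence $\mathcal L_n\in\mathcal R_n$ $(n\ge1)$ satisfies the following conditions, in which $\to_p$ is convergence in probability under $\mathcal L_n$. * (NDG2) For all $n$ and $i\le n$, almost surely $0<\mathrm{Var}_{\widehat{\mathcal L}_n}[X_i\mid Z_i]<\infty$, $0<(Y_i-\widehat\mu_{n,y}(Z_i))^2<\infty$ and $0<(Y_i-\mu_{n,y}(Z_i))^2<\infty$. * (Lyap-2) For some $\delta>0$, $\ n^{-(1+\delta/2)}\sum_{i=1}^n\mathbb E_{\mathcal L_n}\big[|Y_i-\mu_{n,y}(Z_i)|^{2+\delta}\mid Z_i\big]\,\mathbb E_{\widehat{\mathcal L}_n}\big[|\widetilde X_i-\widehat\mu_{n,x}(Z_i)|^{2+\delta}\mid \text{data}\big]\to_p0$. * (SP1') $\sqrt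 n\,E_{n,x}E_{n,y}\to_p0$, $E'_{n,x}\to_p0$, $E'_{n,y}\to_p0$ and $\widehat E'_{n,y}\to_p0$, where $E_{n,x}^2=\frac1n\sum_{i=1}^n(\widehat\mu_{n,x}(Z_i)-\mu_{n,x}(Z_i))^2$, $E_{n,y}^2=\frac1n\sum_{i=1}^n(\widehat\mu_{n,y}(Z_i)-\mu_{n,y}(Z_i))^2$, and $(E'_{n,x})^2$, $(E'_{n,y})^2$, $(\widehat E'_{n,y})^2$ are respectively $E_{n,x}^2$ with its $i$-th summand multiplied by $\mathrm{Var}_{\mathcal L_n}[Y_i\mid Z_i]$, $E_{n,y}^2$ with its $i$-th summand multiplied by $\mathrm{Var}_{\mathcal L_n}[X_i\mid Z_i]$, and $E_{n,y}^2$ with its $i$-th summand multiplied by $\mathrm{Var}_{\widehat{\mathcal L}_n}[X_i\mid Z_i]$. * (SP2) For some $c_1,c_2,\delta>0$, $\ \inf_n\mathbb E_{\mathcal L_n}[(X-\mu_{n,x}(Z))^2(Y-\mu_{n,y}(Z))^2]>c_1$ and $\sup_n\mathbb E_{\mathcal L_n}[|(X-\mu_{n,x}(Z))(Y-\mu_{n,y}(Z))|^{2+\delta}]<c_2$.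 * (Variance consistency) $\frac1n\sum_{i=1}^n\big(\mathrm{Var}_{\widehat{\mathcal L}_n}[X_i\mid Z_i]-\mathrm{Var}_{\mathcal L_n}[X_i\mid Z_i]\big)\mathrm{Var}_{\mathcal L_n}[Y_i\mid Z_i]\to_p0$. Then $$\limsup_{n\to\infty}\ \sup_{\mathcal L_n\in\mathcal L_n^0\cap\mathcal R_n}\mathbb E_{\mathcal L_n}[\phi_n]\le\alpha ,$$ where the supremum over an empty set is $0$. -/

import Mathlib

open MeasureTheory ProbabilityTheory Filter Topology
open scoped ENNReal

namespace DCRT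

noncomputable section

/-- The space of the covariate vector `Z`. -/
abbrev Cov (p : ℕ) : Type := Fin p → ℝ

/-- The space of one observation `(X, Y, Z)`. -/
abbrev Obs (p : ℕ) : Type := ℝ × ℝ × Cov p

/-- The space of a sample of `n` observations `(X_i, Y_i, Z_i)`. -/
abbrev Sample (n p : ℕ) : Type := Fin n → Obs p

/-- The space of the data used to fit one regression on `Z`: `n` values of the regressed variable
(`X` or `Y`) and the `n` covariate vectors. -/
abbrev FitData (n p : ℕ) : Type := (Fin n → ℝ) × (Fin n → Cov p)

/-- The law of an i.i.d. sample of size `n` from `L`. -/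
def sampleLaw (n : ℕ) {p : ℕ} (L : ProbabilityMeasure (Obs p)) : Measure (Sample n p) :=
  Measure.pi fun _ => (L : Measure (Obs p))

/-- The part `(X_i, Z_i)` of the sample. -/
def xzData {n p : ℕ} (s : Sample n p) : FitData n p :=
  (fun i => (s i).1, fun i => (s i).2.2)

/-- The part `(Y_i, Z_i)` of the sample. -/
def yzData {n p : ℕ} (s : Sample n p) : FitData n p :=
  (fun i => (s i).2.1, fun i => (s i).2.2)

/-! ### The true law -/

/-- The conditional law of `X` given `Z`. -/
def lawX {p : ℕ} (L : ProbabilityMeasure (Obs p)) : Kernel (Cov p) ℝ :=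
  condDistrib (fun o : Obs p => o.1) (fun o : Obs p => o.2.2) (L : Measure (Obs p))

/-- The conditional law of `Y` given `Z`. -/
def lawY {p : ℕ} (L : ProbabilityMeasure (Obs p)) : Kernel (Cov p) ℝ :=
  condDistrib (fun o : Obs p => o.2.1) (fun o : Obs p => o.2.2) (L : Measure (Obs p))

/-- The conditional law of `(X, Y)` given `Z`. -/
def lawXY {p : ℕ} (L : ProbabilityMeasure (Obs p)) : Kernel (Cov p) (ℝ × ℝ) :=
  condDistrib (fun o : Obs p => (o.1, o.2.1)) (fun o : Obs p => o.2.2) (L : Measure (Obs p))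

/-- The law of `Z`. -/
def lawZ {p : ℕ} (L : ProbabilityMeasure (Obs p)) : Measure (Cov p) :=
  (L : Measure (Obs p)).map fun o : Obs p => o.2.2

/-- The null laws: `X` and `Y` are conditionally independent given `Z`, that is, the conditional
law of `(X, Y)` given `Z` is the product of those of `X` and of `Y`. -/
def nullLaws (p : ℕ) : Set (ProbabilityMeasure (Obs p)) :=
  {L | ∀ᵐ z ∂(lawZ L), lawXY L z = (lawX L z).prod (lawY L z)}

/-- The mean of a law on the real line. -/
def mean (ν : Measure ℝ) : ℝ := ∫ x, x ∂ν

/-- The variance of a law on the real line (equal to zero if it is infinite). -/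
def var (ν : Measure ℝ) : ℝ := variance id ν

/-- The variance of a law on the real line, possibly infinite. -/
def evar (ν : Measure ℝ) : ℝ≥0∞ := evariance id ν

/-- The conditional variances of `X` and of `Y` given `Z` are finite almost surely. -/
def FiniteCondVar {p : ℕ} (L : ProbabilityMeasure (Obs p)) : Prop :=
  ∀ᵐ z ∂(lawZ L), evar (lawX L z) < ∞ ∧ evar (lawY L z) < ∞

/-- `E[X | Z = z]`. -/
def muX {p : ℕ} (L : ProbabilityMeasure (Obs p)) (z : Cov p) : ℝ := mean (lawX L z)

/-- `E[Y | Z = z]`. -/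
def muY {p : ℕ} (L : ProbabilityMeasure (Obs p)) (z : Cov p) : ℝ := mean (lawY L z)

/-! ### The test -/

/-- The learned law of `X_i` given `Z_i`: the law of `X` given `Z = z` that is learned from the
pairs `(X_j, Z_j)`, at the point `z = Z_i`. -/
def hatLaw {n p : ℕ} (lawHat : Kernel (FitData n p × Cov p) ℝ) (s : Sample n p) (i : Fin n) :
    Measure ℝ :=
  lawHat (xzData s, (s i).2.2)

/-- The fitted value at `Z_i` for `E[X | Z]`: the mean of the learned law. -/
def hatMuX {n p : ℕ} (lawHat : Kernel (FitData n p × Cov p) ℝ) (s : Sample n p) (i : Fin n) : ℝ :=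
  mean (hatLaw lawHat s i)

/-- The fitted value at `Z_i` for `E[Y | Z]`, learned from the pairs `(Y_j, Z_j)`. -/
def hatMuY {n p : ℕ} (muYHat : FitData n p × Cov p → ℝ) (s : Sample n p) (i : Fin n) : ℝ :=
  muYHat (yzData s, (s i).2.2)

/-- The test statistic with `x` in place of the `X_i`, the fits being those of the sample `s`. -/
def resampledStat {n p : ℕ} (lawHat : Kernel (FitData n p × Cov p) ℝ)
    (muYHat : FitData n p × Cov p → ℝ) (s : Sample n p) (x : Fin n → ℝ) : ℝ :=
  (√(n : ℝ))⁻¹ * ∑ i, (x i - hatMuX lawHat s i) * ((s i).2.1 - hatMuY muYHat s i)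

/-- The test statistic of the sample. -/
def stat {n p : ℕ} (lawHat : Kernel (FitData n p × Cov p) ℝ)
    (muYHat : FitData n p × Cov p → ℝ) (s : Sample n p) : ℝ :=
  resampledStat lawHat muYHat s fun i => (s i).1

/-- The resampling law of the test statistic: its conditional law given the sample, when the `X_i`
are redrawn independently from the learned laws given the `Z_i`. -/
def resampledLaw {n p : ℕ} (lawHat : Kernel (FitData n p × Cov p) ℝ)
    (muYHat : FitData n p × Cov p → ℝ) (s : Sample n p) : Measure ℝ :=
  (Measure.pi fun i => hatLaw lawHat s i).map (resampledStat lawHat muYHat s)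

/-- The `a`-quantile of a law on the real line. -/
def quantile (ν : Measure ℝ) (a : ℝ) : ℝ := sInf {t : ℝ | ENNReal.ofReal a ≤ ν (Set.Iic t)}

/-- The test at level `α`: `1` if the statistic exceeds the `1 - α` quantile of its resampling law,
and `0` otherwise. -/
def test {n p : ℕ} (α : ℝ) (lawHat : Kernel (FitData n p × Cov p) ℝ)
    (muYHat : FitData n p × Cov p → ℝ) : Sample n p → ℝ≥0∞ :=
  {s | quantile (resampledLaw lawHat muYHat s) (1 - α) < stat lawHat muYHat s}.indicator 1

/-! ### The conditions on a sequence of laws -/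

/-- `E_{n,x}`, the in-sample error for `E[X | Z]`. -/
def errX {n p : ℕ} (L : ProbabilityMeasure (Obs p)) (lawHat : Kernel (FitData n p × Cov p) ℝ)
    (s : Sample n p) : ℝ :=
  √((n : ℝ)⁻¹ * ∑ i, (hatMuX lawHat s i - muX L (s i).2.2) ^ 2)

/-- `E_{n,y}`, the in-sample error for `E[Y | Z]`. -/
def errY {n p : ℕ} (L : ProbabilityMeasure (Obs p)) (muYHat : FitData n p × Cov p → ℝ)
    (s : Sample n p) : ℝ :=
  √((n : ℝ)⁻¹ * ∑ i, (hatMuY muYHat s i - muY L (s i).2.2) ^ 2)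

/-- `E'_{n,x}`, the in-sample error for `E[X | Z]`, weighted by `Var[Y | Z]`. -/
def errX' {n p : ℕ} (L : ProbabilityMeasure (Obs p)) (lawHat : Kernel (FitData n p × Cov p) ℝ)
    (s : Sample n p) : ℝ :=
  √((n : ℝ)⁻¹ * ∑ i, (hatMuX lawHat s i - muX L (s i).2.2) ^ 2 * var (lawY L (s i).2.2))

/-- `E'_{n,y}`, the in-sample error for `E[Y | Z]`, weighted by `Var[X | Z]`. -/
def errY' {n p : ℕ} (L : ProbabilityMeasure (Obs p)) (muYHat : FitData n p × Cov p → ℝ)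
    (s : Sample n p) : ℝ :=
  √((n : ℝ)⁻¹ * ∑ i, (hatMuY muYHat s i - muY L (s i).2.2) ^ 2 * var (lawX L (s i).2.2))

/-- `Ê'_{n,y}`, the in-sample error for `E[Y | Z]`, weighted by the learned variance of `X`
given `Z`. -/
def hatErrY' {n p : ℕ} (L : ProbabilityMeasure (Obs p)) (lawHat : Kernel (FitData n p × Cov p) ℝ)
    (muYHat : FitData n p × Cov p → ℝ) (s : Sample n p) : ℝ :=
  √((n : ℝ)⁻¹ * ∑ i, (hatMuY muYHat s i - muY L (s i).2.2) ^ 2 * var (hatLaw lawHat s i))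

variable {p : ℕ → ℕ}

/-- Convergence in probability to zero of nonnegative functions `W n` of the sample of size `n`
from `L n`. -/
def ConvProbZero (L : ∀ n, ProbabilityMeasure (Obs (p n))) (W : ∀ n, Sample n (p n) → ℝ≥0∞) :
    Prop :=
  ∀ ε : ℝ, 0 < ε →
    Tendsto (fun n => sampleLaw n (L n) {s | ENNReal.ofReal ε < W n s}) atTop (𝓝 0)

/-- Nondegeneracy. -/
def Nondegenerate (lawHat : ∀ n, Kernel (FitData n (p n) × Cov (p n)) ℝ)
    (muYHat : ∀ n, FitData n (p n) × Cov (p n) → ℝ)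
    (L : ∀ n, ProbabilityMeasure (Obs (p n))) : Prop :=
  ∀ n, 1 ≤ n → ∀ i : Fin n, ∀ᵐ s ∂(sampleLaw n (L n)),
    0 < evar (hatLaw (lawHat n) s i) ∧ evar (hatLaw (lawHat n) s i) < ∞ ∧
    0 < ((s i).2.1 - hatMuY (muYHat n) s i) ^ 2 ∧
    0 < ((s i).2.1 - muY (L n) (s i).2.2) ^ 2

/-- The conditional Lyapunov condition. -/
def Lyapunov (lawHat : ∀ n, Kernel (FitData n (p n) × Cov (p n)) ℝ)
    (L : ∀ n, ProbabilityMeasure (Obs (p n))) : Prop :=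
  ∃ δ : ℝ, 0 < δ ∧ ConvProbZero L fun n s =>
    (∑ i, (∫⁻ y, ‖y - muY (L n) (s i).2.2‖ₑ ^ (2 + δ) ∂(lawY (L n) (s i).2.2)) *
        ∫⁻ x, ‖x - hatMuX (lawHat n) s i‖ₑ ^ (2 + δ) ∂(hatLaw (lawHat n) s i)) /
      (n : ℝ≥0∞) ^ (1 + δ / 2)

/-- The rate conditions on the errors of the two regressions. -/
def ErrorRates (lawHat : ∀ n, Kernel (FitData n (p n) × Cov (p n)) ℝ)
    (muYHat : ∀ n, FitData n (p n) × Cov (p n) → ℝ)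
    (L : ∀ n, ProbabilityMeasure (Obs (p n))) : Prop :=
  ConvProbZero L (fun n s => ‖√(n : ℝ) * (errX (L n) (lawHat n) s * errY (L n) (muYHat n) s)‖ₑ) ∧
  ConvProbZero L (fun n s => ‖errX' (L n) (lawHat n) s‖ₑ) ∧
  ConvProbZero L (fun n s => ‖errY' (L n) (muYHat n) s‖ₑ) ∧
  ConvProbZero L (fun n s => ‖hatErrY' (L n) (lawHat n) (muYHat n) s‖ₑ)

/-- The moment conditions on the product of the true residuals. -/
def MomentBounds (L : ∀ n, ProbabilityMeasure (Obs (p n))) : Prop :=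
  ∃ c₁ c₂ δ : ℝ, 0 < c₁ ∧ 0 < c₂ ∧ 0 < δ ∧
    ENNReal.ofReal c₁ < (⨅ (n : ℕ) (_ : 1 ≤ n), ∫⁻ o, ENNReal.ofReal
        ((o.1 - muX (L n) o.2.2) ^ 2 * (o.2.1 - muY (L n) o.2.2) ^ 2) ∂(L n : Measure (Obs (p n)))) ∧
    (⨆ (n : ℕ) (_ : 1 ≤ n), ∫⁻ o,
        ‖(o.1 - muX (L n) o.2.2) * (o.2.1 - muY (L n) o.2.2)‖ₑ ^ (2 + δ)
          ∂(L n : Measure (Obs (p n)))) < ENNReal.ofReal c₂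

/-- Consistency of the learned conditional variance of `X` given `Z`. -/
def VarianceConsistent (lawHat : ∀ n, Kernel (FitData n (p n) × Cov (p n)) ℝ)
    (L : ∀ n, ProbabilityMeasure (Obs (p n))) : Prop :=
  ConvProbZero L fun n s =>
    ‖(n : ℝ)⁻¹ * ∑ i, (var (hatLaw (lawHat n) s i) - var (lawX (L n) (s i).2.2)) *
      var (lawY (L n) (s i).2.2)‖ₑ

end

end DCRT

/-!
The argument rests on two facts: under the null the statistic is asymptotically normal with variance
`productVar`, and the resampling law has, with high probability, the same normal limit. Hence the
resampling quantile is eventually above every normal quantile of level less than `1 - α`.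

*The statistic.* Writing each fitted value as the true regression plus an error splits the statistic
into the normalized sum of the products of the true residuals and three remainders
(`tendstoZero_stat_sub`). The product of the two errors is bounded by Cauchy–Schwarz. The two mixed
sums are centred given the data of one regression: under the null, redrawing all the `Y_i` (or all
the `X_i`) from their conditional laws given the `Z_i` leaves the law of the sample unchanged
(`lintegral_replaceY`, `lintegral_replaceX`), so a conditional Chebyshev inequality
(`TendstoZeroInProb.of_cond`) bounds them by the weighted errors.

*The resampling law.* Given the sample, the resampled statistic is a sum of independent centred
variables. Its conditional variance is consistent (`tendstoZero_sum_var_hatLaw_mul_resY_sq`): a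
truncation form of the weak law of large numbers (`lintegral_enorm_sum_sub_le`), applied
conditionally on `(X_i, Z_i)`, replaces the squared residuals of `Y` by conditional variances, and
variance consistency followed by the law of large numbers for the true variances does the rest.

*Normal limits.* Both come from one central limit theorem with a uniformity in the summands
(`exists_lyapunov_bound`): closeness of the total variance to `1` and smallness of the Lyapunov
ratio alone bound the probability of a closed set. It is therefore applicable to a single realization of
the data, which avoids conditional weak convergence. The uniformity is extracted from Lévy's
continuity theorem by contradiction (`exists_charFun_close_imp_measure_le`).

The supremum over laws is reduced to one sequence of laws, which need be null only along a filter.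
-/

namespace DCRT

/-! ### Closeness to the normal law from closeness of characteristic functions -/

/-- A quantitative form of Lévy's continuity theorem, obtained from the latter by contradiction: it
turns a bound on characteristic functions over a bounded interval into a bound on probabilities of
a closed set, uniformly over all laws. -/
lemma exists_charFun_close_imp_measure_le (μ : ProbabilityMeasure ℝ) {F : Set ℝ} (hF : IsClosed F)
    {ε : ℝ≥0∞} (hε : 0 < ε) :
    ∃ η : ℝ, 0 < η ∧ ∃ T : ℝ, 0 < T ∧ ∀ ν : Measure ℝ, IsProbabilityMeasure ν →
      (∀ t, |t| ≤ T → ‖charFun ν t - charFun (μ : Measure ℝ) t‖ ≤ η) →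
      ν F ≤ (μ : Measure ℝ) F + ε := by
  by_contra! hcon
  have hk (k : ℕ) := hcon (1 / (k + 1)) (by positivity) (k + 1) (by positivity)
  choose ν hν hclose hlt using hk
  let ν' : ℕ → ProbabilityMeasure ℝ := fun k => ⟨ν k, hν k⟩
  have hlim : Tendsto ν' atTop (𝓝 μ) := by
    refine ProbabilityMeasure.tendsto_of_tendsto_charFun fun t => ?_
    rw [tendsto_iff_norm_sub_tendsto_zero]
    refine squeeze_zero' (.of_forall fun _ => norm_nonneg _) ?_
      tendsto_one_div_add_atTop_nhds_zero_nat
    filter_upwards [eventually_ge_atTop ⌈|t|⌉₊] with k hk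
    refine hclose k t ?_
    have := Nat.le_of_ceil_le hk
    linarith
  have h1 := ProbabilityMeasure.limsup_measure_closed_le_of_tendsto hlim hF
  have h2 : (μ : Measure ℝ) F + ε ≤ limsup (fun k => (ν' k : Measure ℝ) F) atTop :=
    le_limsup_of_frequently_le (.of_forall fun k => (hlt k).le)
  exact (ENNReal.lt_add_right (measure_ne_top _ _) hε.ne').not_ge (h2.trans h1)

/-! ### Lyapunov's central limit theorem, with uniformity in the summands -/

lemma norm_exp_mul_I_sub_le (x : ℝ) :
    ‖Complex.exp (x * Complex.I) - 1 - x * Complex.I + x ^ 2 / 2‖ ≤ 3 * (x ^ 2 * min 1 |x|) := by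
  rcases le_total |x| 1 with hx | hx
  · have h := Complex.exp_bound (x := x * Complex.I) (by simpa using hx) (n := 3) (by norm_num)
    have e : ∑ m ∈ Finset.range 3, ((x : ℂ) * Complex.I) ^ m / (m.factorial : ℂ)
        = 1 + x * Complex.I - x ^ 2 / 2 := by
      simp [Finset.sum_range_succ, mul_pow]; ring
    rw [e] at h
    calc _ = ‖Complex.exp (x * Complex.I) - (1 + x * Complex.I - x ^ 2 / 2)‖ := by congr 1; ring
      _ ≤ _ := h
      _ ≤ _ := by
        rw [min_eq_right hx]
        simp [Nat.factorial]
        have : 0 ≤ |x| ^ 3 := by positivity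
        rw [← sq_abs x]; nlinarith
  · have h1 : ‖Complex.exp (x * Complex.I) - 1‖ ≤ |x| := by
      have := Real.norm_exp_I_mul_ofReal_sub_one_le (x := x)
      rwa [mul_comm] at this
    have h2 : ‖(x : ℂ) * Complex.I‖ = |x| := by simp
    have h3 : ‖(x : ℂ) ^ 2 / 2‖ = |x| ^ 2 / 2 := by simp
    calc _ ≤ ‖Complex.exp (x * Complex.I) - 1‖ + ‖(x : ℂ) * Complex.I‖ + ‖(x : ℂ) ^ 2 / 2‖ :=
          (norm_add_le _ _).trans (add_le_add_left (norm_sub_le _ _) _)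
      _ ≤ |x| + |x| + |x| ^ 2 / 2 := by rw [h2, h3]; gcongr
      _ ≤ _ := by rw [min_eq_left hx, ← sq_abs x]; nlinarith

/-- Truncation at the level `r`, which handles every `δ > 0` at once: the moment of order `2 + δ`
need not lie below the third. -/
lemma sq_mul_min_le {δ r : ℝ} (hδ : 0 < δ) (hr : 0 < r) (y : ℝ) :
    y ^ 2 * min 1 |y| ≤ r * y ^ 2 + r ^ (-δ) * |y| ^ (2 + δ) := by
  rcases le_total |y| r with hy | hy
  · have : 0 ≤ r ^ (-δ) * |y| ^ (2 + δ) := by positivity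
    have := min_le_right 1 |y|
    nlinarith [sq_nonneg y]
  · have hy0 : 0 < |y| := hr.trans_le hy
    have h1 : y ^ 2 ≤ r ^ (-δ) * |y| ^ (2 + δ) := by
      rw [Real.rpow_add hy0, Real.rpow_neg hr.le, Real.rpow_two, sq_abs]
      have : r ^ δ ≤ |y| ^ δ := Real.rpow_le_rpow hr.le hy hδ.le
      have h0 : 0 < r ^ δ := by positivity
      rw [inv_mul_eq_div, le_div_iff₀ h0]
      gcongr
    have : y ^ 2 * min 1 |y| ≤ y ^ 2 := mul_le_of_le_one_right (sq_nonneg y) (min_le_left _ _)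
    nlinarith [sq_nonneg y]

lemma norm_prod_sub_prod_le {ι : Type*} (s : Finset ι) (f g : ι → ℂ)
    (hf : ∀ i, ‖f i‖ ≤ 1) (hg : ∀ i, ‖g i‖ ≤ 1) :
    ‖∏ i ∈ s, f i - ∏ i ∈ s, g i‖ ≤ ∑ i ∈ s, ‖f i - g i‖ := by
  classical
  induction s using Finset.induction_on with
  | empty => simp
  | insert a s ha ih =>
    rw [Finset.prod_insert ha, Finset.prod_insert ha, Finset.sum_insert ha]
    have e : f a * ∏ i ∈ s, f i - g a * ∏ i ∈ s, g i
        = (f a - g a) * ∏ i ∈ s, f i + g a * (∏ i ∈ s, f i - ∏ i ∈ s, g i) := by ring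
    have h1 : ‖∏ i ∈ s, f i‖ ≤ 1 := by
      rw [norm_prod]; exact Finset.prod_le_one (fun _ _ => norm_nonneg _) fun i _ => hf i
    rw [e]
    refine (norm_add_le _ _).trans (add_le_add ?_ ?_)
    · rw [norm_mul]; exact mul_le_of_le_one_right (norm_nonneg _) h1
    · rw [norm_mul]
      exact (mul_le_of_le_one_left (norm_nonneg _) (hg a)).trans ih

lemma abs_exp_neg_sub_le {x : ℝ} (hx : 0 ≤ x) : |Real.exp (-x) - (1 - x)| ≤ x ^ 2 := by
  have h1 := Real.add_one_le_exp (-x)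
  rw [abs_of_nonneg (by linarith)]
  rcases le_total x 1 with h | h
  · have := Real.norm_exp_sub_one_sub_id_le (x := -x) (by simpa [abs_of_nonneg hx] using h)
    simp only [Real.norm_eq_abs, abs_neg, sq_abs] at this
    linarith [le_abs_self (Real.exp (-x) - 1 - -x)]
  · have : Real.exp (-x) ≤ 1 := by simpa using hx
    nlinarith

/-- Second-order expansion of the characteristic function of a centred variable, compared with the
normal one. -/
lemma norm_charFun_sub_exp_le {Ω : Type*} [MeasurableSpace Ω] {ν : Measure Ω}
    [IsProbabilityMeasure ν] {f : Ω → ℝ} (hf : Measurable f) (h2 : Integrable (fun x => f x ^ 2) ν)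
    (h0 : ∫ x, f x ∂ν = 0) {δ r : ℝ} (hδ : 0 < δ) (hr : 0 < r)
    (hm : Integrable (fun x => |f x| ^ (2 + δ)) ν) (t : ℝ) :
    ‖charFun (ν.map f) t - Real.exp (-(t ^ 2 * ∫ x, f x ^ 2 ∂ν) / 2)‖ ≤
      3 * (t ^ 2 * (1 + |t|)) * (r * ∫ x, f x ^ 2 ∂ν + r ^ (-δ) * ∫ x, |f x| ^ (2 + δ) ∂ν) +
        t ^ 4 * (∫ x, f x ^ 2 ∂ν) * (r ^ 2 + r ^ (-δ) * ∫ x, |f x| ^ (2 + δ) ∂ν) := by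
  set v := ∫ x, f x ^ 2 ∂ν with hv
  set m := ∫ x, |f x| ^ (2 + δ) ∂ν with hmdef
  have hv0 : 0 ≤ v := integral_nonneg fun _ => sq_nonneg _
  have hm0 : 0 ≤ m := integral_nonneg fun _ => by positivity
  have hL2 : MemLp f 2 ν := (memLp_two_iff_integrable_sq hf.aestronglyMeasurable).2 h2
  have h1 : Integrable f ν := hL2.integrable (by norm_num)
  have hr' : 0 ≤ r ^ (-δ) := by positivity
  have hpt (x : Ω) : ‖Complex.exp ((t * f x : ℝ) * Complex.I) - 1 - (t * f x : ℝ) * Complex.I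
      + ((t * f x : ℝ) : ℂ) ^ 2 / 2‖ ≤
      3 * (t ^ 2 * (1 + |t|)) * (r * f x ^ 2 + r ^ (-δ) * |f x| ^ (2 + δ)) := by
    refine (norm_exp_mul_I_sub_le _).trans ?_
    have hmin : min 1 |t * f x| ≤ (1 + |t|) * min 1 |f x| := by
      rw [mul_min_of_nonneg _ _ (by positivity), abs_mul]
      refine min_le_min ?_ ?_
      · nlinarith [abs_nonneg t]
      · gcongr; linarith
    calc 3 * ((t * f x) ^ 2 * min 1 |t * f x|)
        ≤ 3 * ((t * f x) ^ 2 * ((1 + |t|) * min 1 |f x|)) := by gcongr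
      _ = 3 * (t ^ 2 * (1 + |t|)) * (f x ^ 2 * min 1 |f x|) := by ring
      _ ≤ _ := by gcongr; exact sq_mul_min_le hδ hr _
  have hA : ‖charFun (ν.map f) t - (1 - t ^ 2 * v / 2 : ℝ)‖ ≤
      3 * (t ^ 2 * (1 + |t|)) * (r * v + r ^ (-δ) * m) := by
    have hexp : Integrable (fun x => Complex.exp ((t * f x : ℝ) * Complex.I)) ν := by
      refine Integrable.of_bound (C := 1) (by fun_prop) (.of_forall fun x => ?_)
      rw [Complex.norm_exp_ofReal_mul_I]
    have hc1 : Integrable (fun x => ((t * f x : ℝ) : ℂ) * Complex.I) ν :=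
      (h1.const_mul t).ofReal.mul_const _
    have hc2 : Integrable (fun x => ((t * f x : ℝ) : ℂ) ^ 2 / 2) ν := by
      have := ((h2.const_mul (t ^ 2)).ofReal (𝕜 := ℂ)).div_const 2
      refine this.congr (.of_forall fun x => ?_)
      simp [mul_pow]
    have e : charFun (ν.map f) t - (1 - t ^ 2 * v / 2 : ℝ) =
        ∫ x, (Complex.exp ((t * f x : ℝ) * Complex.I) - 1 - (t * f x : ℝ) * Complex.I
          + ((t * f x : ℝ) : ℂ) ^ 2 / 2) ∂ν := by
      have i1 : ∫ x, ((t * f x : ℝ) : ℂ) * Complex.I ∂ν = 0 := by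
        rw [integral_mul_const, integral_complex_ofReal, integral_const_mul, h0]; simp
      have i2 : ∫ x, ((t * f x : ℝ) : ℂ) ^ 2 / 2 ∂ν = ((t ^ 2 * v / 2 : ℝ) : ℂ) := by
        rw [integral_div]
        simp_rw [← Complex.ofReal_pow]
        rw [integral_complex_ofReal]
        simp_rw [mul_pow]
        rw [integral_const_mul, ← hv]
        push_cast; rfl
      have hexp1 : Integrable (fun x => Complex.exp ((t * f x : ℝ) * Complex.I) - 1) ν :=
        hexp.sub (integrable_const _)
      have hexp2 : Integrable (fun x => Complex.exp ((t * f x : ℝ) * Complex.I) - 1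
          - (t * f x : ℝ) * Complex.I) ν := hexp1.sub hc1
      rw [integral_add hexp2 hc2, integral_sub hexp1 hc1, integral_sub hexp (integrable_const _),
        i1, i2, charFun_apply_real, integral_map hf.aemeasurable (by fun_prop)]
      simp
      ring
    rw [e]
    refine (norm_integral_le_of_norm_le (g := fun x => 3 * (t ^ 2 * (1 + |t|)) *
      (r * f x ^ 2 + r ^ (-δ) * |f x| ^ (2 + δ))) ?_ (.of_forall hpt)).trans_eq ?_
    · exact ((h2.const_mul r).add (hm.const_mul _)).const_mul _
    · rw [integral_const_mul, integral_add (h2.const_mul r) (hm.const_mul _), integral_const_mul,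
        integral_const_mul]
  have hvle : v ≤ r ^ 2 + r ^ (-δ) * m := by
    have : ∀ x, f x ^ 2 ≤ r ^ 2 + r ^ (-δ) * |f x| ^ (2 + δ) := fun x => by
      rcases le_total |f x| r with hy | hy
      · have h3 : 0 ≤ r ^ (-δ) * |f x| ^ (2 + δ) := by positivity
        have : f x ^ 2 ≤ r ^ 2 := sq_le_sq' (by linarith [neg_abs_le (f x)])
          ((le_abs_self _).trans hy)
        linarith
      · have hy0 : 0 < |f x| := hr.trans_le hy
        rw [Real.rpow_add hy0, Real.rpow_neg hr.le, Real.rpow_two, sq_abs]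
        have : r ^ δ ≤ |f x| ^ δ := Real.rpow_le_rpow hr.le hy hδ.le
        have h0 : 0 < r ^ δ := by positivity
        have : f x ^ 2 ≤ (r ^ δ)⁻¹ * (f x ^ 2 * |f x| ^ δ) := by
          rw [inv_mul_eq_div, le_div_iff₀ h0]
          gcongr
        nlinarith [sq_nonneg r]
    have h := integral_mono h2 ((integrable_const (r ^ 2)).add (hm.const_mul (r ^ (-δ)))) this
    simp only [Pi.add_apply] at h
    rwa [integral_add (integrable_const _) (hm.const_mul _), integral_const_mul, integral_const,
      probReal_univ, one_smul] at h
  have hB : ‖((1 - t ^ 2 * v / 2 : ℝ) : ℂ) - Real.exp (-(t ^ 2 * v) / 2)‖ ≤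
      t ^ 4 * v * (r ^ 2 + r ^ (-δ) * m) := by
    rw [← Complex.ofReal_sub, Complex.norm_real, Real.norm_eq_abs, abs_sub_comm]
    have := abs_exp_neg_sub_le (x := t ^ 2 * v / 2) (by positivity)
    rw [← neg_div] at this
    refine this.trans ?_
    have h4 : 0 ≤ t ^ 4 * v := by positivity
    calc (t ^ 2 * v / 2) ^ 2 = t ^ 4 * v * (v / 4) := by ring
      _ ≤ _ := by gcongr; linarith
  have := norm_sub_le_norm_sub_add_norm_sub (charFun (ν.map f) t) ((1 - t ^ 2 * v / 2 : ℝ) : ℂ)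
    (Real.exp (-(t ^ 2 * v) / 2) : ℂ)
  exact this.trans (add_le_add hA hB)

lemma memLp_of_lintegral_enorm_rpow_ne_top {Ω : Type*} [MeasurableSpace Ω] {ν : Measure Ω}
    {f : Ω → ℝ} (hf : Measurable f) {q : ℝ} (hq : 0 < q) (h : ∫⁻ x, ‖f x‖ₑ ^ q ∂ν ≠ ∞) :
    MemLp f (ENNReal.ofReal q) ν := by
  refine ⟨hf.aestronglyMeasurable, ?_⟩
  rw [eLpNorm_lt_top_iff_lintegral_rpow_enorm_lt_top (by simpa using hq) ENNReal.ofReal_ne_top,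
    ENNReal.toReal_ofReal hq.le]
  exact h.lt_top

/-- Choice of the truncation level `r`, and then of the tolerance `κ`, that makes the error bound
for the characteristic function at most `η` on `[-T, T]`. -/
lemma exists_small_truncation {δ η T : ℝ} (hη : 0 < η) (hT : 0 < T) :
    ∃ r κ : ℝ, 0 < r ∧ 0 < κ ∧ κ ≤ 1 ∧
      3 * (T ^ 2 * (1 + T)) * (r * 2 + r ^ (-δ) * κ) + T ^ 4 * 2 * (r ^ 2 + r ^ (-δ) * κ) +
        T ^ 2 * κ ≤ η := by
  obtain ⟨r, hr, hr0⟩ : ∃ r : ℝ,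
      3 * (T ^ 2 * (1 + T)) * (r * 2) + T ^ 4 * 2 * r ^ 2 < η / 2 ∧ 0 < r := by
    have : Tendsto (fun r : ℝ => 3 * (T ^ 2 * (1 + T)) * (r * 2) + T ^ 4 * 2 * r ^ 2) (𝓝[>] 0)
        (𝓝 0) := by
      have h : Continuous fun r : ℝ => 3 * (T ^ 2 * (1 + T)) * (r * 2) + T ^ 4 * 2 * r ^ 2 := by
        fun_prop
      simpa using (h.tendsto 0).mono_left nhdsWithin_le_nhds
    exact ((this.eventually_lt_const (half_pos hη)).and self_mem_nhdsWithin).exists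
  set A := 3 * (T ^ 2 * (1 + T)) * r ^ (-δ) + T ^ 4 * 2 * r ^ (-δ) + T ^ 2 with hA
  have hA0 : 0 < A := by positivity
  refine ⟨r, min 1 (η / 2 / A), hr0, by positivity, min_le_left _ _, ?_⟩
  have : A * min 1 (η / 2 / A) ≤ η / 2 :=
    (mul_le_mul_of_nonneg_left (min_le_right _ _) hA0.le).trans_eq (by field_simp)
  rw [hA] at this
  linarith

/-- **Lyapunov's central limit theorem**, uniformly in the independent summands: a bound on the
Lyapunov ratio and on the distance of the total variance from `1` controls the probability that the
sum lies in a closed set. The uniformity makes the result applicable to conditional laws. -/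
theorem exists_lyapunov_bound {F : Set ℝ} (hF : IsClosed F) {ε : ℝ≥0∞} (hε : 0 < ε) {δ : ℝ}
    (hδ : 0 < δ) :
    ∃ κ : ℝ, 0 < κ ∧ ∀ {n : ℕ} {Ω : Type} [MeasurableSpace Ω] (ν : Fin n → Measure Ω)
      [∀ i, IsProbabilityMeasure (ν i)] (f : Fin n → Ω → ℝ), (∀ i, Measurable (f i)) →
      (∀ i, ∫ x, f i x ∂(ν i) = 0) → |∑ i, ∫ x, f i x ^ 2 ∂(ν i) - 1| ≤ κ →
      ∑ i, ∫⁻ x, ‖f i x‖ₑ ^ (2 + δ) ∂(ν i) ≤ ENNReal.ofReal κ →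
      Measure.pi ν {ω | ∑ i, f i (ω i) ∈ F} ≤ gaussianReal 0 1 F + ε := by
  obtain ⟨η, hη, T, hT, hclose⟩ :=
    exists_charFun_close_imp_measure_le ⟨gaussianReal 0 1, inferInstance⟩ hF hε
  obtain ⟨r, κ, hr, hκ, hκ1, hle⟩ := exists_small_truncation (δ := δ) hη hT
  refine ⟨κ, hκ, fun {n Ω _} ν _ f hf h0 hV hM => ?_⟩
  have hM' (i : Fin n) : ∫⁻ x, ‖f i x‖ₑ ^ (2 + δ) ∂(ν i) ≠ ∞ :=
    ne_top_of_le_ne_top ENNReal.ofReal_ne_top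
      ((Finset.single_le_sum (fun _ _ => zero_le) (Finset.mem_univ i)).trans hM)
  have hLp (i : Fin n) : MemLp (f i) (ENNReal.ofReal (2 + δ)) (ν i) :=
    memLp_of_lintegral_enorm_rpow_ne_top (hf i) (by linarith) (hM' i)
  have h2 (i : Fin n) : Integrable (fun x => f i x ^ 2) (ν i) := by
    refine ((hLp i).mono_exponent ?_).integrable_sq
    rw [← ENNReal.ofReal_ofNat 2]
    exact ENNReal.ofReal_le_ofReal (by linarith)
  have hm (i : Fin n) : Integrable (fun x => |f i x| ^ (2 + δ)) (ν i) := by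
    have := (hLp i).integrable_norm_rpow (by simpa using by linarith) ENNReal.ofReal_ne_top
    rwa [ENNReal.toReal_ofReal (by linarith)] at this
  set v : Fin n → ℝ := fun i => ∫ x, f i x ^ 2 ∂(ν i) with hv
  set m : Fin n → ℝ := fun i => ∫ x, |f i x| ^ (2 + δ) ∂(ν i) with hmdef
  have hv0 (i : Fin n) : 0 ≤ v i := integral_nonneg fun _ => sq_nonneg _
  have hm0 (i : Fin n) : 0 ≤ m i := integral_nonneg fun _ => by positivity
  have hmM : ∑ i, m i ≤ κ := by
    rw [← ENNReal.ofReal_le_ofReal_iff hκ.le, ENNReal.ofReal_sum_of_nonneg fun i _ => hm0 i]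
    refine le_trans (le_of_eq (Finset.sum_congr rfl fun i _ => ?_)) hM
    rw [hmdef, ofReal_integral_eq_lintegral_ofReal (hm i) (.of_forall fun x => by positivity)]
    refine lintegral_congr fun x => ?_
    rw [← ENNReal.ofReal_rpow_of_nonneg (abs_nonneg _) (by linarith), Real.enorm_eq_ofReal_abs]
  have hV2 : ∑ i, v i ≤ 2 := by linarith [(abs_le.1 hV).2]
  have hmi (i : Fin n) : m i ≤ κ :=
    (Finset.single_le_sum (fun j _ => hm0 j) (Finset.mem_univ i)).trans hmM
  have hmeas : Measurable fun ω : Fin n → Ω => ∑ i, f i (ω i) := by fun_prop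
  have hprob : IsProbabilityMeasure ((Measure.pi ν).map fun ω => ∑ i, f i (ω i)) :=
    Measure.isProbabilityMeasure_map hmeas.aemeasurable
  have := hclose ((Measure.pi ν).map fun ω => ∑ i, f i (ω i)) hprob fun t ht => ?_
  · rwa [Measure.map_apply hmeas hF.measurableSet] at this
  have hind := iIndepFun_pi (μ := ν) (X := f) fun i => (hf i).aemeasurable
  have hchar : charFun ((Measure.pi ν).map fun ω => ∑ i, f i (ω i)) t
      = ∏ i, charFun ((ν i).map (f i)) t := by
    have hmi (i : Fin n) : AEMeasurable (fun ω : Fin n → Ω => f i (ω i)) (Measure.pi ν) :=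
      ((hf i).comp (measurable_pi_apply i)).aemeasurable
    rw [hind.charFun_map_fun_sum_eq_prod hmi, Finset.prod_apply]
    refine Finset.prod_congr rfl fun i _ => ?_
    rw [← (measurePreserving_eval ν i).map_eq, Measure.map_map (hf i) (by fun_prop)]
    rfl
  have hgauss : charFun (gaussianReal 0 1) t = (Real.exp (-t ^ 2 / 2) : ℝ) := by
    rw [charFun_gaussianReal]; push_cast; congr 1; simp; ring
  have hexp : ∏ i, ((Real.exp (-(t ^ 2 * v i) / 2) : ℝ) : ℂ)
      = (Real.exp (-(t ^ 2 * ∑ i, v i) / 2) : ℝ) := by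
    rw [← Complex.ofReal_prod, ← Real.exp_sum, Finset.mul_sum, ← Finset.sum_neg_distrib,
      Finset.sum_div]
  have ht0 := abs_nonneg t
  have hr' : 0 ≤ r ^ (-δ) := by positivity
  have ht2 : t ^ 2 ≤ T ^ 2 := by rw [← sq_abs t]; gcongr
  have ht4 : t ^ 4 ≤ T ^ 4 := by
    rw [show t ^ 4 = (t ^ 2) ^ 2 by ring, show T ^ 4 = (T ^ 2) ^ 2 by ring]; gcongr
  have hA : ‖∏ i, charFun ((ν i).map (f i)) t - ∏ i, ((Real.exp (-(t ^ 2 * v i) / 2) : ℝ) : ℂ)‖ ≤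
      3 * (T ^ 2 * (1 + T)) * (r * 2 + r ^ (-δ) * κ) + T ^ 4 * 2 * (r ^ 2 + r ^ (-δ) * κ) := by
    refine (norm_prod_sub_prod_le _ _ _ (fun i => ?_) fun i => ?_).trans ?_
    · have := Measure.isProbabilityMeasure_map (μ := ν i) (hf i).aemeasurable
      exact norm_charFun_le_one t
    · rw [Complex.norm_real, Real.norm_eq_abs, Real.abs_exp, Real.exp_le_one_iff]
      have : 0 ≤ t ^ 2 * v i := mul_nonneg (sq_nonneg t) (hv0 i)
      linarith
    calc _ ≤ ∑ i, (3 * (T ^ 2 * (1 + T)) * (r * v i + r ^ (-δ) * m i) +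
              T ^ 4 * v i * (r ^ 2 + r ^ (-δ) * κ)) := by
          refine Finset.sum_le_sum fun i _ => ?_
          refine (norm_charFun_sub_exp_le (hf i) (h2 i) (h0 i) hδ hr (hm i) t).trans ?_
          have := hv0 i
          have := hm0 i
          have h5 := hmi i
          change 3 * (t ^ 2 * (1 + |t|)) * (r * v i + r ^ (-δ) * m i) +
            t ^ 4 * v i * (r ^ 2 + r ^ (-δ) * m i) ≤ _
          gcongr
      _ = 3 * (T ^ 2 * (1 + T)) * (r * ∑ i, v i + r ^ (-δ) * ∑ i, m i) +
            T ^ 4 * (∑ i, v i) * (r ^ 2 + r ^ (-δ) * κ) := by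
          rw [Finset.sum_add_distrib, ← Finset.mul_sum, Finset.sum_add_distrib, ← Finset.mul_sum,
            ← Finset.mul_sum, ← Finset.sum_mul, ← Finset.mul_sum]
      _ ≤ _ := by gcongr
  have hB : ‖((Real.exp (-(t ^ 2 * ∑ i, v i) / 2) : ℝ) : ℂ) - (Real.exp (-t ^ 2 / 2) : ℝ)‖ ≤
      T ^ 2 * κ := by
    have hlip (x y : ℝ) (hx : x ≤ 0) (hy : y ≤ 0) : |Real.exp x - Real.exp y| ≤ |x - y| := by
      wlog hxy : x ≤ y generalizing x y
      · rw [abs_sub_comm, abs_sub_comm x]; exact this y x hy hx (le_of_not_ge hxy)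
      rw [abs_sub_comm, abs_sub_comm x, abs_of_nonneg (by simpa using hxy),
        abs_of_nonneg (by linarith)]
      have h1 := Real.add_one_le_exp (x - y)
      have h2 : Real.exp x = Real.exp y * Real.exp (x - y) := by rw [← Real.exp_add]; congr 1; ring
      have h3 : Real.exp y ≤ 1 := by simpa using hy
      have h4 := Real.exp_pos y
      rw [h2]
      nlinarith
    rw [← Complex.ofReal_sub, Complex.norm_real, Real.norm_eq_abs]
    have hV0 : 0 ≤ ∑ i, v i := Finset.sum_nonneg fun i _ => hv0 i
    have : 0 ≤ t ^ 2 * ∑ i, v i := by positivity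
    refine (hlip _ _ (by linarith) (by linarith [sq_nonneg t])).trans ?_
    rw [show -(t ^ 2 * ∑ i, v i) / 2 - -t ^ 2 / 2 = -(t ^ 2 / 2) * (∑ i, v i - 1) by ring, abs_mul,
      abs_neg, abs_of_nonneg (by positivity)]
    gcongr
    linarith [sq_nonneg t]
  rw [hexp] at hA
  change ‖_ - charFun (gaussianReal 0 1) t‖ ≤ η
  rw [hchar, hgauss]
  exact (norm_sub_le_norm_sub_add_norm_sub _ _ _).trans ((add_le_add hA hB).trans hle)

/-! ### Sums of independent variables: second moments and a weak law of large numbers -/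

lemma integral_sum_pi {n : ℕ} {Ω : Type*} [MeasurableSpace Ω] (ν : Fin n → Measure Ω)
    [∀ i, IsProbabilityMeasure (ν i)] {f : Fin n → Ω → ℝ} (hf : ∀ i, Integrable (f i) (ν i)) :
    ∫ ω, ∑ i, f i (ω i) ∂(Measure.pi ν) = ∑ i, ∫ x, f i x ∂(ν i) := by
  have h (i : Fin n) : Integrable (fun ω : Fin n → Ω => f i (ω i)) (Measure.pi ν) :=
    (measurePreserving_eval ν i).integrable_comp_of_integrable (hf i)
  rw [integral_finsetSum _ fun i _ => h i]
  exact Finset.sum_congr rfl fun i _ => integral_comp_eval (hf i).aestronglyMeasurable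

lemma lintegral_sq_sum_sub_eq {n : ℕ} {Ω : Type*} [MeasurableSpace Ω] (ν : Fin n → Measure Ω)
    [∀ i, IsProbabilityMeasure (ν i)] {f : Fin n → Ω → ℝ} (hf : ∀ i, MemLp (f i) 2 (ν i)) :
    ∫⁻ ω, ‖∑ i, f i (ω i) - ∑ i, ∫ x, f i x ∂(ν i)‖ₑ ^ 2 ∂(Measure.pi ν)
      = ENNReal.ofReal (∑ i, Var[f i; ν i]) := by
  have hL : MemLp (∑ i, fun ω : Fin n → Ω => f i (ω i)) 2 (Measure.pi ν) :=
    memLp_finsetSum' _ fun i _ => (hf i).comp_measurePreserving (measurePreserving_eval ν i)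
  rw [← variance_sum_pi hf, hL.ofReal_variance_eq, evariance]
  refine lintegral_congr fun ω => ?_
  simp only [Finset.sum_apply]
  rw [integral_sum_pi ν fun i => (hf i).integrable (by norm_num)]

lemma lintegral_sq_sum_mul_sub_mean {n : ℕ} (ν : Fin n → Measure ℝ)
    [∀ i, IsProbabilityMeasure (ν i)] (hν : ∀ i, evar (ν i) < ∞) (c : Fin n → ℝ) :
    ∫⁻ y, ‖∑ i, c i * (y i - mean (ν i))‖ₑ ^ 2 ∂(Measure.pi ν)
      = ENNReal.ofReal (∑ i, c i ^ 2 * var (ν i)) := by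
  have hid (i : Fin n) : MemLp (fun x : ℝ => x) 2 (ν i) :=
    (evariance_lt_top_iff_memLp aestronglyMeasurable_id).1 (hν i)
  have := lintegral_sq_sum_sub_eq ν (f := fun i x => c i * x) fun i => (hid i).const_mul _
  have hvar (i : Fin n) : Var[fun x => c i * x; ν i] = c i ^ 2 * var (ν i) :=
    variance_const_mul _ _ _
  have hmean (i : Fin n) : ∫ x, c i * x ∂(ν i) = c i * mean (ν i) := integral_const_mul _ _
  simp only [hvar, hmean, ← Finset.sum_sub_distrib, ← mul_sub] at this
  exact this

lemma lintegral_enorm_le_sqrt {Ω : Type*} [MeasurableSpace Ω] {μ : Measure Ω}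
    [IsProbabilityMeasure μ] {f : Ω → ℝ} (hf : AEStronglyMeasurable f μ) {B : ℝ}
    (h : ∫⁻ x, ‖f x‖ₑ ^ 2 ∂μ ≤ ENNReal.ofReal B) :
    ∫⁻ x, ‖f x‖ₑ ∂μ ≤ ENNReal.ofReal √B := by
  have h1 := eLpNorm_le_eLpNorm_of_exponent_le (μ := μ) (f := f) (p := 1) (q := 2)
    (by norm_num) hf
  rw [eLpNorm_one_eq_lintegral_enorm,
    eLpNorm_eq_lintegral_rpow_enorm_toReal (by norm_num) (by norm_num)] at h1
  refine h1.trans ?_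
  simp only [ENNReal.toReal_ofNat, ENNReal.rpow_ofNat]
  refine (ENNReal.rpow_le_rpow h (by norm_num)).trans ?_
  rcases le_total 0 B with hB | hB
  · rw [ENNReal.ofReal_rpow_of_nonneg hB (by norm_num), Real.sqrt_eq_rpow]
  · rw [ENNReal.ofReal_of_nonpos hB, ENNReal.zero_rpow_of_pos (by norm_num)]
    exact zero_le

/-- **Weak law of large numbers** for nonnegative independent variables, in `L¹` and in quantitative
form. It is proved by truncation at the level `r`: the truncated variables have variance at most `r`
times their mean, and the excess is controlled by the moment of order `1 + θ`. -/
theorem lintegral_enorm_sum_sub_le {n : ℕ} {Ω : Type*} [MeasurableSpace Ω] (ν : Fin n → Measure Ω)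
    [∀ i, IsProbabilityMeasure (ν i)] {w : Fin n → Ω → ℝ} (hw : ∀ i, Measurable (w i))
    (hw0 : ∀ i x, 0 ≤ w i x) (hint : ∀ i, Integrable (w i) (ν i)) {θ r : ℝ} (hθ : 0 < θ)
    (hr : 0 < r) :
    ∫⁻ ω, ‖∑ i, w i (ω i) - ∑ i, ∫ x, w i x ∂(ν i)‖ₑ ∂(Measure.pi ν) ≤
      ENNReal.ofReal √(r * ∑ i, ∫ x, w i x ∂(ν i)) +
        2 * (ENNReal.ofReal (r ^ (-θ)) * ∑ i, ∫⁻ x, ‖w i x‖ₑ ^ (1 + θ) ∂(ν i)) := by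
  set u : Fin n → Ω → ℝ := fun i x => min (w i x) r with hu
  set d : Fin n → Ω → ℝ := fun i x => w i x - u i x with hd
  have hum (i : Fin n) : Measurable (u i) := (hw i).min measurable_const
  have hdm (i : Fin n) : Measurable (d i) := (hw i).sub (hum i)
  have hu0 (i : Fin n) (x : Ω) : 0 ≤ u i x := le_min (hw0 i x) hr.le
  have hd0 (i : Fin n) (x : Ω) : 0 ≤ d i x := sub_nonneg.2 (min_le_left _ _)
  have huL (i : Fin n) : MemLp (u i) 2 (ν i) := by
    refine MemLp.of_bound (hum i).aestronglyMeasurable r (.of_forall fun x => ?_)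
    rw [Real.norm_of_nonneg (hu0 i x)]
    exact min_le_right _ _
  have hui (i : Fin n) : Integrable (u i) (ν i) := (huL i).integrable (by norm_num)
  have hdi (i : Fin n) : Integrable (d i) (ν i) := (hint i).sub (hui i)
  have hdle (i : Fin n) (x : Ω) : ‖d i x‖ₑ ≤ ENNReal.ofReal (r ^ (-θ)) * ‖w i x‖ₑ ^ (1 + θ) := by
    rw [Real.enorm_of_nonneg (hd0 i x), Real.enorm_of_nonneg (hw0 i x),
      ENNReal.ofReal_rpow_of_nonneg (hw0 i x) (by linarith), ← ENNReal.ofReal_mul (by positivity)]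
    refine ENNReal.ofReal_le_ofReal ?_
    rcases le_total (w i x) r with h | h
    · have : d i x = 0 := by simp [hd, hu, min_eq_left h]
      rw [this]
      have := hw0 i x
      positivity
    · have hpos : 0 < w i x := hr.trans_le h
      have h1 : d i x ≤ w i x := sub_le_self _ (hu0 i x)
      refine h1.trans ?_
      rw [Real.rpow_add hpos, Real.rpow_neg hr.le, Real.rpow_one, inv_mul_eq_div,
        le_div_iff₀ (by positivity)]
      gcongr
  set D := ENNReal.ofReal (r ^ (-θ)) * ∑ i, ∫⁻ x, ‖w i x‖ₑ ^ (1 + θ) ∂(ν i) with hD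
  have hdD : ∑ i, ∫⁻ x, ‖d i x‖ₑ ∂(ν i) ≤ D := by
    rw [hD, Finset.mul_sum]
    refine Finset.sum_le_sum fun i _ => ?_
    rw [← lintegral_const_mul _ (by fun_prop)]
    exact lintegral_mono (hdle i)
  have hdecomp (ω : Fin n → Ω) : ∑ i, w i (ω i) - ∑ i, ∫ x, w i x ∂(ν i) =
      (∑ i, u i (ω i) - ∑ i, ∫ x, u i x ∂(ν i)) + ∑ i, d i (ω i) - ∑ i, ∫ x, d i x ∂(ν i) := by
    have : ∀ i, ∫ x, d i x ∂(ν i) = ∫ x, w i x ∂(ν i) - ∫ x, u i x ∂(ν i) := fun i =>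
      integral_sub (hint i) (hui i)
    simp_rw [this, hd, Finset.sum_sub_distrib]
    ring
  have hUm : Measurable fun ω : Fin n → Ω => ∑ i, u i (ω i) - ∑ i, ∫ x, u i x ∂(ν i) := by
    fun_prop
  have hDm : Measurable fun ω : Fin n → Ω => ∑ i, ‖d i (ω i)‖ₑ := by fun_prop
  have hpt (ω : Fin n → Ω) : ‖∑ i, w i (ω i) - ∑ i, ∫ x, w i x ∂(ν i)‖ₑ ≤
      ‖∑ i, u i (ω i) - ∑ i, ∫ x, u i x ∂(ν i)‖ₑ + ∑ i, ‖d i (ω i)‖ₑ + D := by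
    rw [hdecomp]
    refine (enorm_sub_le).trans (add_le_add ((enorm_add_le _ _).trans
      (add_le_add_right (enorm_sum_le _ _) _)) ?_)
    refine (enorm_sum_le _ _).trans (le_trans (Finset.sum_le_sum fun i _ => ?_) hdD)
    exact enorm_integral_le_lintegral_enorm _
  have hU : ∫⁻ ω, ‖∑ i, u i (ω i) - ∑ i, ∫ x, u i x ∂(ν i)‖ₑ ∂(Measure.pi ν) ≤
      ENNReal.ofReal √(r * ∑ i, ∫ x, w i x ∂(ν i)) := by
    refine lintegral_enorm_le_sqrt hUm.aestronglyMeasurable ?_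
    rw [lintegral_sq_sum_sub_eq ν huL, Finset.mul_sum]
    refine ENNReal.ofReal_le_ofReal (Finset.sum_le_sum fun i _ => ?_)
    refine (variance_le_expectation_sq (hum i).aestronglyMeasurable).trans ?_
    rw [← integral_const_mul]
    refine integral_mono (huL i).integrable_sq ((hint i).const_mul r) fun x => ?_
    have h1 : u i x ≤ r := min_le_right _ _
    have h2 : u i x ≤ w i x := min_le_left _ _
    have h3 := hu0 i x
    simp only [Pi.pow_apply]
    nlinarith
  calc _ ≤ ∫⁻ ω, ‖∑ i, u i (ω i) - ∑ i, ∫ x, u i x ∂(ν i)‖ₑ + ∑ i, ‖d i (ω i)‖ₑ + D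
          ∂(Measure.pi ν) := lintegral_mono hpt
    _ = ∫⁻ ω, ‖∑ i, u i (ω i) - ∑ i, ∫ x, u i x ∂(ν i)‖ₑ ∂(Measure.pi ν) +
          ∑ i, ∫⁻ x, ‖d i x‖ₑ ∂(ν i) + D := by
        rw [lintegral_add_right _ measurable_const, lintegral_add_right _ hDm, lintegral_const,
          measure_univ, mul_one, lintegral_finsetSum _ fun i _ => by fun_prop]
        congr 2
        refine Finset.sum_congr rfl fun i _ => ?_
        exact (measurePreserving_eval ν i).lintegral_comp (hdm i).enorm
    _ ≤ _ := by
        rw [two_mul, ← add_assoc]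
        gcongr

/-! ### Resampling one coordinate of each observation -/

lemma measurable_pi_kernel {n : ℕ} {Ω Ω' : Type*} [MeasurableSpace Ω] [MeasurableSpace Ω']
    (K : Kernel Ω Ω') [IsMarkovKernel K] :
    Measurable fun s : Fin n → Ω => Measure.pi fun i => K (s i) := by
  refine .measure_of_isPiSystem_of_isProbabilityMeasure generateFrom_pi.symm isPiSystem_pi ?_
  rintro _ ⟨A, hA, rfl⟩
  simp only [Measure.pi_pi]
  exact Finset.measurable_fun_prod _ fun i _ =>
    (K.measurable_coe (hA i (Set.mem_univ i))).comp (measurable_pi_apply i)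

/-- If replacing part of an observation by a draw from the kernel `K` leaves its law unchanged, then
doing so independently for each observation leaves the law of an i.i.d. sample unchanged. -/
theorem lintegral_pi_resample {n : ℕ} {Ω Ω' : Type*} [MeasurableSpace Ω] [MeasurableSpace Ω']
    (μ : Measure Ω) [IsProbabilityMeasure μ] (K : Kernel Ω Ω') [IsMarkovKernel K]
    {g : Ω → Ω' → Ω} (hg : Measurable (Function.uncurry g))
    (hinv : ∀ A, MeasurableSet A → ∫⁻ o, K o {y | g o y ∈ A} ∂μ = μ A)
    {F : (Fin n → Ω) → ℝ≥0∞} (hF : Measurable F) :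
    ∫⁻ s, F s ∂(Measure.pi fun _ => μ) =
      ∫⁻ s, ∫⁻ y, F (fun i => g (s i) (y i)) ∂(Measure.pi fun i => K (s i))
        ∂(Measure.pi fun _ => μ) := by
  let κ : Kernel (Fin n → Ω) (Fin n → Ω') := ⟨_, measurable_pi_kernel K⟩
  have : IsMarkovKernel κ := ⟨fun s => by change IsProbabilityMeasure (Measure.pi _); infer_instance⟩
  let G : (Fin n → Ω) × (Fin n → Ω') → Fin n → Ω := fun q i => g (q.1 i) (q.2 i)
  have hG : Measurable G := by
    refine measurable_pi_lambda _ fun i => ?_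
    have h : Measurable fun q : (Fin n → Ω) × (Fin n → Ω') => (q.1 i, q.2 i) := by fun_prop
    exact hg.comp h
  have key : Measure.pi (fun _ : Fin n => μ) = ((Measure.pi fun _ => μ) ⊗ₘ κ).map G := by
    refine Measure.pi_eq fun A hA => ?_
    rw [Measure.map_apply hG (.univ_pi hA), Measure.compProd_apply (hG (.univ_pi hA))]
    have h1 (s : Fin n → Ω) : κ s (Prod.mk s ⁻¹' (G ⁻¹' Set.univ.pi A)) =
        ∏ i, K (s i) {y | g (s i) y ∈ A i} := by
      rw [← Measure.pi_pi]
      congr 1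
    have hm (i : Fin n) : Measurable fun o => K o {y | g o y ∈ A i} :=
      Kernel.measurable_kernel_prodMk_left (κ := K) (hg (hA i))
    simp_rw [h1]
    have hind := iIndepFun_pi (μ := fun _ : Fin n => μ)
      (X := fun i o => K o {y | g o y ∈ A i}) fun i => (hm i).aemeasurable
    rw [lintegral_prod_eq_prod_lintegral_of_indepFun _ _ hind
      fun i => (hm i).comp (measurable_pi_apply i)]
    refine Finset.prod_congr rfl fun i _ => ?_
    rw [← hinv _ (hA i)]
    exact ((measurePreserving_eval (fun _ : Fin n => μ) i).lintegral_comp (hm i))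
  conv_lhs => rw [key]
  have hFG : Measurable fun q => F (G q) := hF.comp hG
  rw [lintegral_map hF hG, Measure.lintegral_compProd hFG]
  rfl

/-! ### Convergence in probability -/

/-- Convergence in probability to zero, along a filter, of nonnegative functions defined on
probability spaces that vary with the index. -/
def TendstoZeroInProb {Ω : ℕ → Type*} [∀ n, MeasurableSpace (Ω n)] (l : Filter ℕ)
    (P : ∀ n, Measure (Ω n)) (W : ∀ n, Ω n → ℝ≥0∞) : Prop :=
  ∀ ε : ℝ, 0 < ε → Tendsto (fun n => P n {s | ENNReal.ofReal ε < W n s}) l (𝓝 0)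

namespace TendstoZeroInProb

variable {Ω : ℕ → Type*} [∀ n, MeasurableSpace (Ω n)] {l : Filter ℕ} {P : ∀ n, Measure (Ω n)}
  {W W' : ∀ n, Ω n → ℝ≥0∞}

/-- Deterministic transfer: smallness of `W` and `W'` at a point forces smallness of `V` there. -/
lemma of_imp₂ (h : TendstoZeroInProb l P W) (h' : TendstoZeroInProb l P W')
    {V : ∀ n, Ω n → ℝ≥0∞}
    (hV : ∀ ε : ℝ, 0 < ε → ∃ κ : ℝ, 0 < κ ∧ ∀ᶠ n in l, ∀ᵐ s ∂(P n),
      W n s ≤ ENNReal.ofReal κ → W' n s ≤ ENNReal.ofReal κ → V n s ≤ ENNReal.ofReal ε) :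
    TendstoZeroInProb l P V := by
  intro ε hε
  obtain ⟨κ, hκ, hev⟩ := hV ε hε
  have := (h κ hκ).add (h' κ hκ)
  rw [add_zero] at this
  refine tendsto_of_tendsto_of_tendsto_of_le_of_le' tendsto_const_nhds this
    (.of_forall fun _ => zero_le) ?_
  filter_upwards [hev] with n hn
  refine le_trans (measure_mono_ae ?_) (measure_union_le _ _)
  filter_upwards [hn] with s hs hlt
  by_contra hcon
  change ¬ (_ ∨ _) at hcon
  rw [not_or] at hcon
  exact (hs (not_lt.1 hcon.1) (not_lt.1 hcon.2)).not_gt hlt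

lemma of_imp (h : TendstoZeroInProb l P W) {V : ∀ n, Ω n → ℝ≥0∞}
    (hV : ∀ ε : ℝ, 0 < ε → ∃ κ : ℝ, 0 < κ ∧ ∀ᶠ n in l, ∀ᵐ s ∂(P n),
      W n s ≤ ENNReal.ofReal κ → V n s ≤ ENNReal.ofReal ε) :
    TendstoZeroInProb l P V :=
  h.of_imp₂ h fun ε hε => (hV ε hε).imp fun _ hκ =>
    ⟨hκ.1, hκ.2.mono fun _ hn => hn.mono fun _ hs h1 _ => hs h1⟩

lemma of_le (h : TendstoZeroInProb l P W) {V : ∀ n, Ω n → ℝ≥0∞}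
    (hV : ∀ᶠ n in l, ∀ᵐ s ∂(P n), V n s ≤ W n s) : TendstoZeroInProb l P V :=
  h.of_imp fun ε hε => ⟨ε, hε, hV.mono fun _ hn => hn.mono fun _ hs => hs.trans⟩

lemma add (h : TendstoZeroInProb l P W) (h' : TendstoZeroInProb l P W') :
    TendstoZeroInProb l P fun n s => W n s + W' n s :=
  h.of_imp₂ h' fun ε hε => ⟨ε / 2, half_pos hε, .of_forall fun _ => .of_forall fun _ h1 h2 =>
    (add_le_add h1 h2).trans_eq (by
      rw [← ENNReal.ofReal_add (half_pos hε).le (half_pos hε).le, add_halves])⟩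

/-- Conditional Markov inequality, in the limit: if the distribution `P n` is unchanged when the
point `s` is replaced by `g n s y` with `y` drawn from `K n s`, and the resulting conditional
expectation of `W n` tends to zero in probability, then so does `W n`. -/
theorem of_cond {Ω' : ℕ → Type*} [∀ n, MeasurableSpace (Ω' n)] [∀ n, IsProbabilityMeasure (P n)]
    (K : ∀ n, Ω n → Measure (Ω' n)) [∀ n s, IsProbabilityMeasure (K n s)]
    (g : ∀ n, Ω n → Ω' n → Ω n) (hg : ∀ n s, Measurable (g n s))
    (hres : ∀ᶠ n in l, ∀ F : Ω n → ℝ≥0∞, Measurable F →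
      ∫⁻ s, F s ∂(P n) = ∫⁻ s, ∫⁻ y, F (g n s y) ∂(K n s) ∂(P n))
    (hW : ∀ n, Measurable (W n))
    (hle : ∀ᶠ n in l, ∀ᵐ s ∂(P n), ∫⁻ y, W n (g n s y) ∂(K n s) ≤ W' n s)
    (h : TendstoZeroInProb l P W') : TendstoZeroInProb l P W := by
  intro ε hε
  rw [ENNReal.tendsto_nhds_zero]
  intro η hη
  obtain ⟨η', hη'0, hη'⟩ : ∃ η' : ℝ, 0 < η' ∧ ENNReal.ofReal η' ≤ η := by
    rcases eq_or_ne η ∞ with rfl | htop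
    · exact ⟨1, one_pos, le_top⟩
    · exact ⟨η.toReal, ENNReal.toReal_pos hη.ne' htop, ENNReal.ofReal_toReal_le⟩
  have h1 := (ENNReal.tendsto_nhds_zero.1 (h (ε * (η' / 2)) (by positivity)))
    (ENNReal.ofReal (η' / 2)) (by simpa using hη'0)
  filter_upwards [hres, hle, h1] with n hn hnle hn1
  refine le_trans ?_ hη'
  have hset : MeasurableSet {s | ENNReal.ofReal ε < W n s} := measurableSet_lt measurable_const (hW n)
  -- `W'` need not be measurable, so its exceptional set is enlarged to a measurable one
  set B := toMeasurable (P n) {s | ENNReal.ofReal (ε * (η' / 2)) < W' n s} with hB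
  have hBm : MeasurableSet B := measurableSet_toMeasurable _ _
  calc P n {s | ENNReal.ofReal ε < W n s}
      = ∫⁻ s, ∫⁻ y, {s | ENNReal.ofReal ε < W n s}.indicator 1 (g n s y) ∂(K n s) ∂(P n) := by
        rw [← hn _ (measurable_one.indicator hset), lintegral_indicator_one hset]
    _ ≤ ∫⁻ s, B.indicator 1 s + ENNReal.ofReal (η' / 2) ∂(P n) := by
        refine lintegral_mono_ae ?_
        filter_upwards [hnle] with s hs
        by_cases hsB : s ∈ B
        · rw [Set.indicator_of_mem hsB]
          refine le_trans (le_trans (lintegral_mono (g := fun _ => 1) fun y => ?_) ?_) le_self_add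
          · exact Set.indicator_le_self' (fun _ _ => zero_le) _ |>.trans le_rfl
          · simp
        · have hsle : W' n s ≤ ENNReal.ofReal (ε * (η' / 2)) :=
            not_lt.1 fun hlt => hsB (subset_toMeasurable _ _ hlt)
          rw [Set.indicator_of_notMem hsB, zero_add]
          have hmk := mul_meas_ge_le_lintegral (μ := K n s) ((hW n).comp (hg n s))
            (ENNReal.ofReal ε)
          have h2 : ENNReal.ofReal ε * K n s {y | ENNReal.ofReal ε ≤ W n (g n s y)} ≤
              ENNReal.ofReal ε * ENNReal.ofReal (η' / 2) := by
            rw [← ENNReal.ofReal_mul hε.le]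
            exact hmk.trans (hs.trans hsle)
          rw [ENNReal.mul_le_mul_iff_right (by simpa using hε) ENNReal.ofReal_ne_top] at h2
          refine le_trans ?_ h2
          have : (fun y => {s | ENNReal.ofReal ε < W n s}.indicator (1 : Ω n → ℝ≥0∞) (g n s y)) =
              {y | ENNReal.ofReal ε < W n (g n s y)}.indicator 1 := rfl
          rw [this]
          exact (lintegral_indicator_one_le _).trans
            (measure_mono (Set.ofPred_subset_ofPred.2 fun y hy => hy.le))
    _ ≤ ENNReal.ofReal (η' / 2) + ENNReal.ofReal (η' / 2) := by
        rw [lintegral_add_right _ measurable_const, lintegral_indicator_one hBm, lintegral_const,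
          measure_univ, mul_one, hB, measure_toMeasurable]
        gcongr
    _ = ENNReal.ofReal η' := by
        rw [← ENNReal.ofReal_add (half_pos hη'0).le (half_pos hη'0).le, add_halves]

lemma of_lintegral [∀ n, IsProbabilityMeasure (P n)] (hW : ∀ n, Measurable (W n))
    (h : Tendsto (fun n => ∫⁻ s, W n s ∂(P n)) l (𝓝 0)) : TendstoZeroInProb l P W := by
  intro ε hε
  have hε' : ENNReal.ofReal ε ≠ 0 := by simpa using hε
  have := ENNReal.Tendsto.div_const h (b := ENNReal.ofReal ε) (.inr hε')
  rw [ENNReal.zero_div] at this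
  refine tendsto_of_tendsto_of_tendsto_of_le_of_le tendsto_const_nhds this (fun _ => zero_le)
    fun n => ?_
  refine le_trans (measure_mono (Set.ofPred_subset_ofPred.2 fun s hs => hs.le))
    (meas_ge_le_lintegral_div (hW n).aemeasurable hε' ENNReal.ofReal_ne_top)

end TendstoZeroInProb

/-! ### Moments of conditional laws and their measurability -/

lemma measurable_mean_kernel {α : Type*} [MeasurableSpace α] (K : Kernel α ℝ) [IsMarkovKernel K] :
    Measurable fun a => mean (K a) :=
  (StronglyMeasurable.integral_kernel (f := fun x : ℝ => x) stronglyMeasurable_id).measurable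

lemma measurable_lintegral_sub_mean {α : Type*} [MeasurableSpace α] (K : Kernel α ℝ)
    [IsMarkovKernel K] (q : ℝ) : Measurable fun a => ∫⁻ x, ‖x - mean (K a)‖ₑ ^ q ∂(K a) := by
  have hK : Measurable fun q' : α × ℝ => mean (K q'.1) :=
    (measurable_mean_kernel K).comp measurable_fst
  exact Measurable.lintegral_kernel_prod_right' (κ := K)
    (f := fun q' : α × ℝ => ‖q'.2 - mean (K q'.1)‖ₑ ^ q) (by fun_prop)

lemma evar_eq (ν : Measure ℝ) : evar ν = ∫⁻ x, ‖x - mean ν‖ₑ ^ (2 : ℝ) ∂ν := by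
  simp only [evar, evariance, mean, id, ENNReal.rpow_ofNat]

lemma measurable_evar_kernel {α : Type*} [MeasurableSpace α] (K : Kernel α ℝ) [IsMarkovKernel K] :
    Measurable fun a => evar (K a) := by
  simp_rw [evar_eq]
  exact measurable_lintegral_sub_mean K 2

lemma measurable_var_kernel {α : Type*} [MeasurableSpace α] (K : Kernel α ℝ) [IsMarkovKernel K] :
    Measurable fun a => var (K a) :=
  (measurable_evar_kernel K).ennreal_toReal

lemma ofReal_var {ν : Measure ℝ} (h : evar ν < ∞) : ENNReal.ofReal (var ν) = evar ν :=
  ENNReal.ofReal_toReal h.ne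

lemma var_nonneg (ν : Measure ℝ) : 0 ≤ var ν := variance_nonneg _ _

/-- Jensen's inequality between the central moments of orders `2` and `2 + δ`. -/
lemma evar_rpow_le (ν : Measure ℝ) [IsProbabilityMeasure ν] {δ : ℝ} (hδ : 0 < δ) :
    evar ν ^ (1 + δ / 2) ≤ ∫⁻ x, ‖x - mean ν‖ₑ ^ (2 + δ) ∂ν := by
  have h := eLpNorm_le_eLpNorm_of_exponent_le (μ := ν) (f := fun x : ℝ => x - mean ν) (p := 2)
    (q := ENNReal.ofReal (2 + δ))
    (by rw [← ENNReal.ofReal_ofNat 2]; exact ENNReal.ofReal_le_ofReal (by linarith)) (by fun_prop)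
  rw [eLpNorm_eq_lintegral_rpow_enorm_toReal (by norm_num) (by norm_num),
    eLpNorm_eq_lintegral_rpow_enorm_toReal (by simpa using by linarith) ENNReal.ofReal_ne_top,
    ENNReal.toReal_ofReal (by linarith), ENNReal.toReal_ofNat, ← evar_eq] at h
  have h2 := ENNReal.rpow_le_rpow h (z := 2 + δ) (by linarith)
  rwa [← ENNReal.rpow_mul, ← ENNReal.rpow_mul, one_div_mul_cancel (by linarith), ENNReal.rpow_one,
    show 1 / 2 * (2 + δ) = 1 + δ / 2 by ring] at h2

instance {p : ℕ} (L : ProbabilityMeasure (Obs p)) : IsMarkovKernel (lawX L) := by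
  unfold lawX; infer_instance

instance {p : ℕ} (L : ProbabilityMeasure (Obs p)) : IsMarkovKernel (lawY L) := by
  unfold lawY; infer_instance

instance {p : ℕ} (L : ProbabilityMeasure (Obs p)) : IsMarkovKernel (lawXY L) := by
  unfold lawXY; infer_instance

instance {p : ℕ} (L : ProbabilityMeasure (Obs p)) : IsProbabilityMeasure (lawZ L) :=
  Measure.isProbabilityMeasure_map (by fun_prop)

instance {n p : ℕ} (L : ProbabilityMeasure (Obs p)) : IsProbabilityMeasure (sampleLaw n L) := by
  unfold sampleLaw; infer_instance

instance {n p : ℕ} (lawHat : Kernel (FitData n p × Cov p) ℝ) [IsMarkovKernel lawHat]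
    (s : Sample n p) (i : Fin n) : IsProbabilityMeasure (hatLaw lawHat s i) := by
  unfold hatLaw; infer_instance

lemma measurable_muX {p : ℕ} (L : ProbabilityMeasure (Obs p)) : Measurable (muX L) :=
  measurable_mean_kernel _

lemma measurable_muY {p : ℕ} (L : ProbabilityMeasure (Obs p)) : Measurable (muY L) :=
  measurable_mean_kernel _

lemma measurable_xzData_prod {n p : ℕ} (i : Fin n) :
    Measurable fun s : Sample n p => (xzData s, (s i).2.2) := by
  unfold xzData; fun_prop

lemma measurable_yzData_prod {n p : ℕ} (i : Fin n) :
    Measurable fun s : Sample n p => (yzData s, (s i).2.2) := by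
  unfold yzData; fun_prop

lemma measurable_hatMuX {n p : ℕ} (lawHat : Kernel (FitData n p × Cov p) ℝ)
    [IsMarkovKernel lawHat] (i : Fin n) : Measurable fun s : Sample n p => hatMuX lawHat s i :=
  (measurable_mean_kernel lawHat).comp (measurable_xzData_prod i)

lemma measurable_var_hatLaw {n p : ℕ} (lawHat : Kernel (FitData n p × Cov p) ℝ)
    [IsMarkovKernel lawHat] (i : Fin n) :
    Measurable fun s : Sample n p => var (hatLaw lawHat s i) :=
  (measurable_var_kernel lawHat).comp (measurable_xzData_prod i)

lemma measurable_moment_hatLaw {n p : ℕ} (lawHat : Kernel (FitData n p × Cov p) ℝ)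
    [IsMarkovKernel lawHat] (i : Fin n) (q : ℝ) :
    Measurable fun s : Sample n p =>
      ∫⁻ x, ‖x - hatMuX lawHat s i‖ₑ ^ q ∂(hatLaw lawHat s i) :=
  (measurable_lintegral_sub_mean lawHat q).comp (measurable_xzData_prod i)

lemma measurable_hatMuY {n p : ℕ} {muYHat : FitData n p × Cov p → ℝ} (hm : Measurable muYHat)
    (i : Fin n) : Measurable fun s : Sample n p => hatMuY muYHat s i :=
  hm.comp (measurable_yzData_prod i)

/-! ### Consequences of conditional independence -/

section Null

variable {n p : ℕ} {L : ProbabilityMeasure (Obs p)}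

/-- Integration against a null law: first the law of `Z`, then independently those of `X` and `Y`
given `Z`. -/
lemma lintegral_of_mem_nullLaws (hL : L ∈ nullLaws p) {F : Obs p → ℝ≥0∞} (hF : Measurable F) :
    ∫⁻ o, F o ∂(L : Measure (Obs p)) =
      ∫⁻ z, ∫⁻ x, ∫⁻ y, F (x, y, z) ∂(lawY L z) ∂(lawX L z) ∂(lawZ L) := by
  have hdis : lawZ L ⊗ₘ lawXY L =
      (L : Measure (Obs p)).map fun o : Obs p => (o.2.2, (o.1, o.2.1)) :=
    compProd_map_condDistrib (by fun_prop)
  have hF' : Measurable fun q : Cov p × (ℝ × ℝ) => F (q.2.1, q.2.2, q.1) := by fun_prop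
  calc ∫⁻ o, F o ∂(L : Measure (Obs p))
      = ∫⁻ q, F (q.2.1, q.2.2, q.1) ∂(lawZ L ⊗ₘ lawXY L) := by
        rw [hdis, lintegral_map hF' (by fun_prop)]
    _ = ∫⁻ z, ∫⁻ q, F (q.1, q.2, z) ∂(lawXY L z) ∂(lawZ L) := Measure.lintegral_compProd hF'
    _ = _ := by
        refine lintegral_congr_ae ?_
        filter_upwards [hL] with z hz
        rw [hz, lintegral_prod _ (by fun_prop)]

/-- Under the null, redrawing `Y` from its conditional law given `Z` alone preserves the law of
`(X, Y, Z)`, although `X` is kept. -/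
lemma lintegral_lawY_of_mem_nullLaws (hL : L ∈ nullLaws p) {A : Set (Obs p)}
    (hA : MeasurableSet A) :
    ∫⁻ o, lawY L o.2.2 {y | (o.1, y, o.2.2) ∈ A} ∂(L : Measure (Obs p)) = (L : Measure _) A := by
  have hm : Measurable fun o : Obs p => lawY L o.2.2 {y | (o.1, y, o.2.2) ∈ A} := by
    have hg : Measurable fun q : Obs p × ℝ => ((q.1.1, q.2, q.1.2.2) : Obs p) := by fun_prop
    exact Kernel.measurable_kernel_prodMk_left
      (κ := (lawY L).comap (fun o : Obs p => o.2.2) (by fun_prop)) (hg hA)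
  rw [lintegral_of_mem_nullLaws hL hm, ← lintegral_indicator_one hA,
    lintegral_of_mem_nullLaws hL (measurable_one.indicator hA)]
  refine lintegral_congr fun z => lintegral_congr fun x => ?_
  have hs : MeasurableSet {y | (x, y, z) ∈ A} := by
    have hg : Measurable fun y : ℝ => ((x, y, z) : Obs p) := by fun_prop
    exact hg hA
  dsimp only
  rw [lintegral_const, measure_univ, mul_one, ← lintegral_indicator_one hs]
  rfl

lemma lintegral_lawX_of_mem_nullLaws (hL : L ∈ nullLaws p) {A : Set (Obs p)}
    (hA : MeasurableSet A) :
    ∫⁻ o, lawX L o.2.2 {x | (x, o.2.1, o.2.2) ∈ A} ∂(L : Measure (Obs p)) = (L : Measure _) A := by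
  have hm : Measurable fun o : Obs p => lawX L o.2.2 {x | (x, o.2.1, o.2.2) ∈ A} := by
    have hg : Measurable fun q : Obs p × ℝ => ((q.2, q.1.2.1, q.1.2.2) : Obs p) := by fun_prop
    exact Kernel.measurable_kernel_prodMk_left
      (κ := (lawX L).comap (fun o : Obs p => o.2.2) (by fun_prop)) (hg hA)
  rw [lintegral_of_mem_nullLaws hL hm, ← lintegral_indicator_one hA,
    lintegral_of_mem_nullLaws hL (measurable_one.indicator hA)]
  refine lintegral_congr fun z => ?_
  have hind : Measurable fun q : ℝ × ℝ => A.indicator (1 : Obs p → ℝ≥0∞) (q.1, q.2, z) :=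
    (measurable_one.indicator hA).comp (by fun_prop)
  dsimp only
  rw [lintegral_const, measure_univ, mul_one, lintegral_lintegral_swap hind.aemeasurable]
  refine lintegral_congr fun y => ?_
  have hs : MeasurableSet {x | (x, y, z) ∈ A} := by
    have hg : Measurable fun x : ℝ => ((x, y, z) : Obs p) := by fun_prop
    exact hg hA
  rw [← lintegral_indicator_one hs]
  rfl

/-- The sample with the values of `Y` replaced by `y`. -/
def replaceY (s : Sample n p) (y : Fin n → ℝ) : Sample n p :=
  fun i => ((s i).1, y i, (s i).2.2)

/-- The sample with the values of `X` replaced by `x`. -/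
def replaceX (s : Sample n p) (x : Fin n → ℝ) : Sample n p :=
  fun i => (x i, (s i).2.1, (s i).2.2)

lemma measurable_replaceY (s : Sample n p) : Measurable (replaceY s) := by
  unfold replaceY; fun_prop

lemma measurable_replaceX (s : Sample n p) : Measurable (replaceX s) := by
  unfold replaceX; fun_prop

/-- Redrawing all the `Y_i` from their conditional laws given the `Z_i` leaves the law of a sample
from a null law unchanged. -/
lemma lintegral_replaceY (hL : L ∈ nullLaws p) {F : Sample n p → ℝ≥0∞} (hF : Measurable F) :
    ∫⁻ s, F s ∂(sampleLaw n L) =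
      ∫⁻ s, ∫⁻ y, F (replaceY s y) ∂(Measure.pi fun i => lawY L (s i).2.2) ∂(sampleLaw n L) :=
  lintegral_pi_resample (L : Measure (Obs p))
    ((lawY L).comap (fun o : Obs p => o.2.2) (by fun_prop)) (g := fun o y => (o.1, y, o.2.2))
    (by unfold Function.uncurry; fun_prop) (fun _ hA => lintegral_lawY_of_mem_nullLaws hL hA) hF

lemma lintegral_replaceX (hL : L ∈ nullLaws p) {F : Sample n p → ℝ≥0∞} (hF : Measurable F) :
    ∫⁻ s, F s ∂(sampleLaw n L) =
      ∫⁻ s, ∫⁻ x, F (replaceX s x) ∂(Measure.pi fun i => lawX L (s i).2.2) ∂(sampleLaw n L) :=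
  lintegral_pi_resample (L : Measure (Obs p))
    ((lawX L).comap (fun o : Obs p => o.2.2) (by fun_prop)) (g := fun o x => (x, o.2.1, o.2.2))
    (by unfold Function.uncurry; fun_prop) (fun _ hA => lintegral_lawX_of_mem_nullLaws hL hA) hF

lemma FiniteCondVar.ae_sample (h : FiniteCondVar L) :
    ∀ᵐ s ∂(sampleLaw n L), ∀ i, evar (lawX L (s i).2.2) < ∞ ∧ evar (lawY L (s i).2.2) < ∞ := by
  rw [ae_all_iff]
  intro i
  have h1 : ∀ᵐ o ∂(L : Measure (Obs p)), evar (lawX L o.2.2) < ∞ ∧ evar (lawY L o.2.2) < ∞ :=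
    ae_of_ae_map (by fun_prop) h
  exact (measurePreserving_eval (fun _ : Fin n => (L : Measure (Obs p))) i).quasiMeasurePreserving.ae
    h1

end Null

/-! ### The remainder of the test statistic -/

section Remainder

variable {p : ℕ → ℕ} {L : ∀ n, ProbabilityMeasure (Obs (p n))}
  {lawHat : ∀ n, Kernel (FitData n (p n) × Cov (p n)) ℝ}
  {muYHat : ∀ n, FitData n (p n) × Cov (p n) → ℝ} {l : Filter ℕ}

lemma enorm_sqrt_sq {x : ℝ} (hx : 0 ≤ x) : ‖√x‖ₑ ^ 2 = ENNReal.ofReal x := by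
  rw [Real.enorm_of_nonneg (Real.sqrt_nonneg _), ← ENNReal.ofReal_pow (Real.sqrt_nonneg _),
    Real.sq_sqrt hx]

lemma TendstoZeroInProb.enorm_sq_iff {Ω : ℕ → Type*} [∀ n, MeasurableSpace (Ω n)]
    {P : ∀ n, Measure (Ω n)} {W : ∀ n, Ω n → ℝ} :
    TendstoZeroInProb l P (fun n s => ‖W n s‖ₑ ^ 2) ↔ TendstoZeroInProb l P fun n s => ‖W n s‖ₑ := by
  constructor
  · refine fun h => h.of_imp fun ε hε => ⟨ε ^ 2, by positivity, .of_forall fun n =>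
      .of_forall fun s hs => ?_⟩
    rw [ENNReal.ofReal_pow hε.le] at hs
    exact (ENNReal.pow_le_pow_left_iff two_ne_zero).1 hs
  · refine fun h => h.of_imp fun ε hε => ⟨√ε, by positivity, .of_forall fun n =>
      .of_forall fun s hs => ?_⟩
    calc ‖W n s‖ₑ ^ 2 ≤ ENNReal.ofReal √ε ^ 2 := by gcongr
      _ = ENNReal.ofReal ε := by
        rw [← ENNReal.ofReal_pow (Real.sqrt_nonneg _), Real.sq_sqrt hε.le]

/-- The error of the regression of `X` times the residual of `Y` averages out: given the pairs
`(X_i, Z_i)` the residuals of `Y` are independent and centred under the null. -/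
lemma tendstoZero_errX_mul_resY [∀ n, IsMarkovKernel (lawHat n)]
    (hnull : ∀ᶠ n in l, L n ∈ nullLaws (p n)) (hfin : ∀ᶠ n in l, FiniteCondVar (L n))
    (h : TendstoZeroInProb l (fun n => sampleLaw n (L n))
      fun n s => ‖errX' (L n) (lawHat n) s‖ₑ) :
    TendstoZeroInProb l (fun n => sampleLaw n (L n)) fun n s =>
      ‖∑ i, (√(n : ℝ))⁻¹ * (hatMuX (lawHat n) s i - muX (L n) (s i).2.2) *
        ((s i).2.1 - muY (L n) (s i).2.2)‖ₑ := by
  rw [← TendstoZeroInProb.enorm_sq_iff] at h ⊢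
  refine TendstoZeroInProb.of_cond (fun n s => Measure.pi fun i => lawY (L n) (s i).2.2)
    (fun n => replaceY) (fun n s => measurable_replaceY s)
    (hnull.mono fun n hn F hF => lintegral_replaceY hn hF) (fun n => ?_) ?_ h
  · have := measurable_hatMuX (lawHat n)
    have := measurable_muX (L n)
    have := measurable_muY (L n)
    fun_prop
  filter_upwards [hfin] with n hn
  filter_upwards [hn.ae_sample] with s hs
  refine le_of_eq ?_
  refine (lintegral_sq_sum_mul_sub_mean _ (fun i => (hs i).2) fun i =>
    (√(n : ℝ))⁻¹ * (hatMuX (lawHat n) s i - muX (L n) (s i).2.2)).trans ?_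
  rw [errX', enorm_sqrt_sq (mul_nonneg (by positivity) (Finset.sum_nonneg fun i _ =>
    mul_nonneg (sq_nonneg _) (var_nonneg _))), Finset.mul_sum]
  congr 1
  refine Finset.sum_congr rfl fun i _ => ?_
  rw [mul_pow, inv_pow, Real.sq_sqrt (Nat.cast_nonneg n)]
  ring

/-- The counterpart with the roles of `X` and `Y` exchanged, given the pairs `(Y_i, Z_i)`. -/
lemma tendstoZero_resX_mul_errY (hmuYHat : ∀ n, Measurable (muYHat n))
    (hnull : ∀ᶠ n in l, L n ∈ nullLaws (p n)) (hfin : ∀ᶠ n in l, FiniteCondVar (L n))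
    (h : TendstoZeroInProb l (fun n => sampleLaw n (L n))
      fun n s => ‖errY' (L n) (muYHat n) s‖ₑ) :
    TendstoZeroInProb l (fun n => sampleLaw n (L n)) fun n s =>
      ‖∑ i, (√(n : ℝ))⁻¹ * (hatMuY (muYHat n) s i - muY (L n) (s i).2.2) *
        ((s i).1 - muX (L n) (s i).2.2)‖ₑ := by
  rw [← TendstoZeroInProb.enorm_sq_iff] at h ⊢
  refine TendstoZeroInProb.of_cond (fun n s => Measure.pi fun i => lawX (L n) (s i).2.2)
    (fun n => replaceX) (fun n s => measurable_replaceX s)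
    (hnull.mono fun n hn F hF => lintegral_replaceX hn hF) (fun n => ?_) ?_ h
  · have := measurable_hatMuY (hmuYHat n)
    have := measurable_muX (L n)
    have := measurable_muY (L n)
    fun_prop
  filter_upwards [hfin] with n hn
  filter_upwards [hn.ae_sample] with s hs
  refine le_of_eq ?_
  refine (lintegral_sq_sum_mul_sub_mean _ (fun i => (hs i).1) fun i =>
    (√(n : ℝ))⁻¹ * (hatMuY (muYHat n) s i - muY (L n) (s i).2.2)).trans ?_
  rw [errY', enorm_sqrt_sq (mul_nonneg (by positivity) (Finset.sum_nonneg fun i _ =>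
    mul_nonneg (sq_nonneg _) (var_nonneg _))), Finset.mul_sum]
  congr 1
  refine Finset.sum_congr rfl fun i _ => ?_
  rw [mul_pow, inv_pow, Real.sq_sqrt (Nat.cast_nonneg n)]
  ring

lemma abs_sum_errX_mul_errY_le {n q : ℕ} (L : ProbabilityMeasure (Obs q))
    (lawHat : Kernel (FitData n q × Cov q) ℝ) (muYHat : FitData n q × Cov q → ℝ)
    (s : Sample n q) :
    |∑ i, (√(n : ℝ))⁻¹ * (hatMuX lawHat s i - muX L (s i).2.2) *
        (hatMuY muYHat s i - muY L (s i).2.2)| ≤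
      |√(n : ℝ) * (errX L lawHat s * errY L muYHat s)| := by
  rcases Nat.eq_zero_or_pos n with rfl | hn
  · simp
  have hn' : (0 : ℝ) < n := by exact_mod_cast hn
  rw [abs_of_nonneg (a := √(n : ℝ) * _) (by unfold errX errY; positivity)]
  have hcs := (Finset.abs_sum_le_sum_abs (fun i => (hatMuX lawHat s i - muX L (s i).2.2) *
    (hatMuY muYHat s i - muY L (s i).2.2)) Finset.univ).trans_eq (Finset.sum_congr rfl fun _ _ =>
      abs_mul _ _) |>.trans (Real.sum_mul_le_sqrt_mul_sqrt _ _ _)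
  simp_rw [sq_abs] at hcs
  simp_rw [mul_assoc]
  rw [← Finset.mul_sum, abs_mul, abs_of_nonneg (by positivity : (0 : ℝ) ≤ (√(n : ℝ))⁻¹), errX, errY,
    Real.sqrt_mul (by positivity), Real.sqrt_mul (by positivity), Real.sqrt_inv]
  refine (mul_le_mul_of_nonneg_left hcs (by positivity)).trans_eq ?_
  have : √(n : ℝ) ≠ 0 := by positivity
  field_simp

/-- The test statistic differs negligibly from the normalized sum of the products of the true
residuals. -/
theorem tendstoZero_stat_sub (hmuYHat : ∀ n, Measurable (muYHat n)) [∀ n, IsMarkovKernel (lawHat n)]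
    (hl : l ≤ atTop)
    (hnull : ∀ᶠ n in l, L n ∈ nullLaws (p n)) (hfin : ∀ᶠ n in l, FiniteCondVar (L n))
    (h : ErrorRates lawHat muYHat L) :
    TendstoZeroInProb l (fun n => sampleLaw n (L n)) fun n s =>
      ‖stat (lawHat n) (muYHat n) s - ∑ i, (√(n : ℝ))⁻¹ *
        (((s i).1 - muX (L n) (s i).2.2) * ((s i).2.1 - muY (L n) (s i).2.2))‖ₑ := by
  obtain ⟨hxy, hx, hy, -⟩ := h
  have h1 := tendstoZero_errX_mul_resY hnull hfin fun ε hε => (hx ε hε).mono_left hl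
  have h2 := tendstoZero_resX_mul_errY hmuYHat hnull hfin fun ε hε => (hy ε hε).mono_left hl
  have h3 : TendstoZeroInProb l (fun n => sampleLaw n (L n)) fun n s =>
      ‖√(n : ℝ) * (errX (L n) (lawHat n) s * errY (L n) (muYHat n) s)‖ₑ :=
    fun ε hε => (hxy ε hε).mono_left hl
  refine ((h1.add h2).add h3).of_le (.of_forall fun n => .of_forall fun s => ?_)
  have h4 : ‖∑ i, (√(n : ℝ))⁻¹ * (hatMuX (lawHat n) s i - muX (L n) (s i).2.2) *
      (hatMuY (muYHat n) s i - muY (L n) (s i).2.2)‖ₑ ≤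
      ‖√(n : ℝ) * (errX (L n) (lawHat n) s * errY (L n) (muYHat n) s)‖ₑ := by
    rw [Real.enorm_eq_ofReal_abs, Real.enorm_eq_ofReal_abs]
    exact ENNReal.ofReal_le_ofReal (abs_sum_errX_mul_errY_le _ _ _ _)
  refine le_trans ?_ (add_le_add_right h4 _)
  refine le_trans (le_of_eq ?_) ((enorm_sub_le).trans (add_le_add_left
    ((enorm_add_le _ _).trans_eq rfl) _))
  rw [← enorm_neg]
  congr 1
  rw [stat, resampledStat, Finset.mul_sum, ← Finset.sum_sub_distrib, ← Finset.sum_add_distrib,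
    ← Finset.sum_sub_distrib, ← Finset.sum_neg_distrib]
  refine Finset.sum_congr rfl fun i _ => ?_
  ring

end Remainder

/-! ### The variance of the product of the true residuals -/

section ProductVar

variable {p : ℕ} {L : ProbabilityMeasure (Obs p)}

/-- The second moment `E[(X - E[X | Z])² (Y - E[Y | Z])²]` of the product of the true residuals,
which under the null is the variance of the limit law of the test statistic. -/
noncomputable def productVar (L : ProbabilityMeasure (Obs p)) : ℝ :=
  (∫⁻ o, ENNReal.ofReal ((o.1 - muX L o.2.2) ^ 2 * (o.2.1 - muY L o.2.2) ^ 2)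
    ∂(L : Measure (Obs p))).toReal

lemma measurable_resX (L : ProbabilityMeasure (Obs p)) :
    Measurable fun o : Obs p => o.1 - muX L o.2.2 := by
  have := measurable_muX L
  fun_prop

lemma measurable_resY (L : ProbabilityMeasure (Obs p)) :
    Measurable fun o : Obs p => o.2.1 - muY L o.2.2 := by
  have := measurable_muY L
  fun_prop

lemma ofReal_resX_sq_mul_resY_sq (o : Obs p) :
    ENNReal.ofReal ((o.1 - muX L o.2.2) ^ 2 * (o.2.1 - muY L o.2.2) ^ 2) =
      ‖(o.1 - muX L o.2.2) * (o.2.1 - muY L o.2.2)‖ₑ ^ 2 := by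
  rw [Real.enorm_eq_ofReal_abs, ← ENNReal.ofReal_pow (abs_nonneg _), sq_abs, mul_pow]

/-- Conditional expectations given `Z` factorize under the null. -/
lemma lintegral_mul_of_mem_nullLaws (hL : L ∈ nullLaws p) {f g : ℝ × Cov p → ℝ≥0∞}
    (hf : Measurable f) (hg : Measurable g) :
    ∫⁻ o, f (o.1, o.2.2) * g (o.2.1, o.2.2) ∂(L : Measure (Obs p)) =
      ∫⁻ o, (∫⁻ x, f (x, o.2.2) ∂(lawX L o.2.2)) * ∫⁻ y, g (y, o.2.2) ∂(lawY L o.2.2)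
        ∂(L : Measure (Obs p)) := by
  have hf' (z : Cov p) : Measurable fun x => f (x, z) := by fun_prop
  have hg' (z : Cov p) : Measurable fun y => g (y, z) := by fun_prop
  have hfK : Measurable fun z => ∫⁻ x, f (x, z) ∂(lawX L z) :=
    Measurable.lintegral_kernel_prod_right' (κ := lawX L) (f := fun q => f (q.2, q.1))
      (by fun_prop)
  have hgK : Measurable fun z => ∫⁻ y, g (y, z) ∂(lawY L z) :=
    Measurable.lintegral_kernel_prod_right' (κ := lawY L) (f := fun q => g (q.2, q.1))
      (by fun_prop)
  rw [lintegral_of_mem_nullLaws hL (by fun_prop)]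
  have hmap := lintegral_map (μ := (L : Measure (Obs p))) (hfK.mul hgK)
    (g := fun o : Obs p => o.2.2) (by fun_prop)
  refine Eq.trans ?_ hmap
  refine lintegral_congr fun z => ?_
  simp_rw [lintegral_const_mul _ (hg' z)]
  rw [lintegral_mul_const _ (hf' z)]
  rfl

/-- Under the null, the second moment of the product of the residuals is the mean of the product of
the conditional variances. -/
lemma lintegral_resX_sq_mul_resY_sq (hL : L ∈ nullLaws p) :
    ∫⁻ o, ENNReal.ofReal ((o.1 - muX L o.2.2) ^ 2 * (o.2.1 - muY L o.2.2) ^ 2)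
        ∂(L : Measure (Obs p)) =
      ∫⁻ o, evar (lawX L o.2.2) * evar (lawY L o.2.2) ∂(L : Measure (Obs p)) := by
  have hX := measurable_muX L
  have hY := measurable_muY L
  have := lintegral_mul_of_mem_nullLaws hL (f := fun q => ‖q.1 - muX L q.2‖ₑ ^ (2 : ℝ))
    (g := fun q => ‖q.1 - muY L q.2‖ₑ ^ (2 : ℝ)) (by fun_prop) (by fun_prop)
  simp_rw [evar_eq]
  refine Eq.trans (lintegral_congr fun o => ?_) this
  rw [ofReal_resX_sq_mul_resY_sq, enorm_mul, mul_pow, ENNReal.rpow_ofNat, ENNReal.rpow_ofNat]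

lemma lintegral_evar_mul_evar_rpow_le (hL : L ∈ nullLaws p) {δ : ℝ} (hδ : 0 < δ) :
    ∫⁻ o, (evar (lawX L o.2.2) * evar (lawY L o.2.2)) ^ (1 + δ / 2) ∂(L : Measure (Obs p)) ≤
      ∫⁻ o, ‖(o.1 - muX L o.2.2) * (o.2.1 - muY L o.2.2)‖ₑ ^ (2 + δ) ∂(L : Measure (Obs p)) := by
  have hX := measurable_muX L
  have hY := measurable_muY L
  have := lintegral_mul_of_mem_nullLaws hL (f := fun q => ‖q.1 - muX L q.2‖ₑ ^ (2 + δ))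
    (g := fun q => ‖q.1 - muY L q.2‖ₑ ^ (2 + δ)) (by fun_prop) (by fun_prop)
  calc _ ≤ _ := lintegral_mono fun o => ?_
    _ = _ := this.symm
    _ = _ := lintegral_congr fun o => ?_
  · rw [ENNReal.mul_rpow_of_nonneg _ _ (by linarith)]
    exact mul_le_mul' (evar_rpow_le _ hδ) (evar_rpow_le _ hδ)
  · rw [enorm_mul, ENNReal.mul_rpow_of_nonneg _ _ (by linarith)]

/-- A finite variance makes `mean ν` a genuine integral, so that subtracting it centres `ν`. -/
lemma integral_sub_mean {ν : Measure ℝ} [IsProbabilityMeasure ν] (h : evar ν < ∞) :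
    ∫ x, (x - mean ν) ∂ν = 0 := by
  have hid : MemLp (fun x : ℝ => x) 2 ν :=
    (evariance_lt_top_iff_memLp aestronglyMeasurable_id).1 h
  rw [integral_sub (hid.integrable (by norm_num)) (integrable_const _), integral_const,
    probReal_univ, one_smul, mean, sub_self]

lemma integral_resX_mul_resY (hL : L ∈ nullLaws p) (hfin : FiniteCondVar L)
    (hint : Integrable (fun o : Obs p => (o.1 - muX L o.2.2) * (o.2.1 - muY L o.2.2)) L) :
    ∫ o, (o.1 - muX L o.2.2) * (o.2.1 - muY L o.2.2) ∂(L : Measure (Obs p)) = 0 := by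
  have hX := measurable_muX L
  have hY := measurable_muY L
  have hdis : lawZ L ⊗ₘ lawXY L =
      (L : Measure (Obs p)).map fun o : Obs p => (o.2.2, (o.1, o.2.1)) :=
    compProd_map_condDistrib (by fun_prop)
  set f : Cov p × (ℝ × ℝ) → ℝ := fun q => (q.2.1 - muX L q.1) * (q.2.2 - muY L q.1) with hf
  have hfm : Measurable f := by fun_prop
  have hmeas : Measurable fun o : Obs p => (o.2.2, (o.1, o.2.1)) := by fun_prop
  have hfi : Integrable f (lawZ L ⊗ₘ lawXY L) := by
    rw [hdis, integrable_map_measure hfm.aestronglyMeasurable hmeas.aemeasurable]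
    exact hint
  have h1 : ∫ o, (o.1 - muX L o.2.2) * (o.2.1 - muY L o.2.2) ∂(L : Measure (Obs p)) =
      ∫ q, f q ∂(lawZ L ⊗ₘ lawXY L) := by
    rw [hdis, integral_map hmeas.aemeasurable hfm.aestronglyMeasurable]
  rw [h1, Measure.integral_compProd hfi]
  refine integral_eq_zero_of_ae ?_
  filter_upwards [hL, hfin] with z hz hzfin
  rw [hz]
  refine (integral_prod_mul (fun x => x - muX L z) fun y => y - muY L z).trans ?_
  rw [muX, integral_sub_mean hzfin.1, zero_mul]
  rfl

end ProductVar

section Sequences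

variable {p : ℕ → ℕ} {L : ∀ n, ProbabilityMeasure (Obs (p n))}
  {lawHat : ∀ n, Kernel (FitData n (p n) × Cov (p n)) ℝ}
  {muYHat : ∀ n, FitData n (p n) × Cov (p n) → ℝ} {l : Filter ℕ}

/-- The moment conditions with constants that serve every `n`. -/
structure UniformMoments (L : ∀ n, ProbabilityMeasure (Obs (p n))) (c₁ c₂ δ : ℝ) : Prop where
  pos₁ : 0 < c₁
  pos₂ : 0 < c₂
  pos : 0 < δ
  le_productVar : ∀ n, 1 ≤ n → c₁ ≤ productVar (L n)
  productVar_le : ∀ n, 1 ≤ n → productVar (L n) ≤ 1 + c₂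
  ofReal_productVar : ∀ n, 1 ≤ n → ENNReal.ofReal (productVar (L n)) =
    ∫⁻ o, ENNReal.ofReal ((o.1 - muX (L n) o.2.2) ^ 2 * (o.2.1 - muY (L n) o.2.2) ^ 2)
      ∂(L n : Measure (Obs (p n)))
  moment_le : ∀ n, 1 ≤ n → ∫⁻ o, ‖(o.1 - muX (L n) o.2.2) * (o.2.1 - muY (L n) o.2.2)‖ₑ ^ (2 + δ)
    ∂(L n : Measure (Obs (p n))) ≤ ENNReal.ofReal c₂

lemma MomentBounds.exists_uniformMoments (h : MomentBounds L) :
    ∃ c₁ c₂ δ, UniformMoments L c₁ c₂ δ := by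
  obtain ⟨c₁, c₂, δ, h₁, h₂, hδ, hinf, hsup⟩ := h
  have hm (n : ℕ) (hn : 1 ≤ n) : ∫⁻ o, ‖(o.1 - muX (L n) o.2.2) * (o.2.1 - muY (L n) o.2.2)‖ₑ ^
      (2 + δ) ∂(L n : Measure (Obs (p n))) ≤ ENNReal.ofReal c₂ :=
    (le_iSup₂ (f := fun (n : ℕ) (_ : 1 ≤ n) => ∫⁻ o, ‖(o.1 - muX (L n) o.2.2) *
      (o.2.1 - muY (L n) o.2.2)‖ₑ ^ (2 + δ) ∂(L n : Measure (Obs (p n)))) n hn).trans hsup.le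
  have hle (n : ℕ) (hn : 1 ≤ n) : ∫⁻ o, ENNReal.ofReal ((o.1 - muX (L n) o.2.2) ^ 2 *
      (o.2.1 - muY (L n) o.2.2) ^ 2) ∂(L n : Measure (Obs (p n))) ≤ ENNReal.ofReal (1 + c₂) := by
    calc _ ≤ ∫⁻ o, 1 + ‖(o.1 - muX (L n) o.2.2) * (o.2.1 - muY (L n) o.2.2)‖ₑ ^ (2 + δ)
            ∂(L n : Measure (Obs (p n))) := by
          refine lintegral_mono fun o => ?_
          rw [ofReal_resX_sq_mul_resY_sq]
          set e := ‖(o.1 - muX (L n) o.2.2) * (o.2.1 - muY (L n) o.2.2)‖ₑ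
          rcases le_total e 1 with he | he
          · exact (pow_le_one' he 2).trans le_self_add
          · rw [← ENNReal.rpow_ofNat]
            refine le_trans (ENNReal.rpow_le_rpow_of_exponent_le he ?_) le_add_self
            change (2 : ℝ) ≤ 2 + δ
            linarith
      _ ≤ _ := by
          rw [lintegral_add_left measurable_const, lintegral_const, measure_univ, mul_one,
            ENNReal.ofReal_add one_pos.le h₂.le, ENNReal.ofReal_one]
          gcongr
          exact hm n hn
  have hfin (n : ℕ) (hn : 1 ≤ n) := ENNReal.ofReal_toReal
    (ne_top_of_le_ne_top ENNReal.ofReal_ne_top (hle n hn))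
  refine ⟨c₁, c₂, δ, h₁, h₂, hδ, fun n hn => ?_, fun n hn => ?_, hfin, hm⟩
  · refine (ENNReal.ofReal_le_iff_le_toReal
      (ne_top_of_le_ne_top ENNReal.ofReal_ne_top (hle n hn))).1 (hinf.le.trans ?_)
    exact iInf₂_le (f := fun (n : ℕ) (_ : 1 ≤ n) => ∫⁻ o, ENNReal.ofReal
      ((o.1 - muX (L n) o.2.2) ^ 2 * (o.2.1 - muY (L n) o.2.2) ^ 2)
        ∂(L n : Measure (Obs (p n)))) n hn
  · exact ENNReal.toReal_le_of_le_ofReal (by linarith) (hle n hn)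

lemma UniformMoments.productVar_pos {c₁ c₂ δ : ℝ} (h : UniformMoments L c₁ c₂ δ) {n : ℕ}
    (hn : 1 ≤ n) : 0 < productVar (L n) :=
  h.pos₁.trans_le (h.le_productVar n hn)

/-! ### Limit law of the normalized sum of the products of the true residuals -/

lemma tendsto_ofReal_rpow_neg {c q : ℝ} (hq : 0 < q) :
    Tendsto (fun n : ℕ => ENNReal.ofReal (c * (n : ℝ) ^ (-q))) atTop (𝓝 0) := by
  have h := ((tendsto_rpow_neg_atTop hq).comp tendsto_natCast_atTop_atTop).const_mul c
  rw [mul_zero] at h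
  simpa using ENNReal.tendsto_ofReal h

/-- The central limit theorem for the normalized sum of the products of the true residuals, which
under the null are centred because the two factors are conditionally independent. -/
theorem eventually_sampleLaw_sum_le {c₁ c₂ δ : ℝ} (hmom : UniformMoments L c₁ c₂ δ)
    (hl : l ≤ atTop) (hnull : ∀ᶠ n in l, L n ∈ nullLaws (p n))
    (hfin : ∀ᶠ n in l, FiniteCondVar (L n)) {F : Set ℝ} (hF : IsClosed F) {ε : ℝ≥0∞}
    (hε : 0 < ε) :
    ∀ᶠ n in l, sampleLaw n (L n) {s | ∑ i, (√(n : ℝ) * √(productVar (L n)))⁻¹ *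
        (((s i).1 - muX (L n) (s i).2.2) * ((s i).2.1 - muY (L n) (s i).2.2)) ∈ F} ≤
      gaussianReal 0 1 F + ε := by
  obtain ⟨κ, hκ, hclt⟩ := exists_lyapunov_bound hF hε hmom.pos
  have hδ := hmom.pos
  have hsmall : ∀ᶠ n : ℕ in l,
      ENNReal.ofReal ((√c₁)⁻¹ ^ (2 + δ) * c₂ * (n : ℝ) ^ (-(δ / 2))) ≤ ENNReal.ofReal κ :=
    hl ((tendsto_ofReal_rpow_neg (half_pos hδ)).eventually_le_const (by simpa using hκ))
  filter_upwards [hsmall, hnull, hfin, hl (eventually_ge_atTop 1)] with n hn hnulln hfinn hn1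
  have hn0 : (0 : ℝ) < n := by exact_mod_cast hn1
  have hσ := hmom.productVar_pos hn1
  set a := (√(n : ℝ) * √(productVar (L n)))⁻¹ with ha
  have ha0 : 0 < a := by positivity
  have hmeas : Measurable fun o : Obs (p n) =>
      (o.1 - muX (L n) o.2.2) * (o.2.1 - muY (L n) o.2.2) :=
    (measurable_resX _).mul (measurable_resY _)
  have hmn := hmom.moment_le n hn1
  have hL2 : MemLp (fun o : Obs (p n) => (o.1 - muX (L n) o.2.2) * (o.2.1 - muY (L n) o.2.2)) 2
      (L n : Measure (Obs (p n))) := by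
    refine (memLp_of_lintegral_enorm_rpow_ne_top hmeas (q := 2 + δ) (by linarith)
      (ne_top_of_le_ne_top ENNReal.ofReal_ne_top hmn)).mono_exponent ?_
    rw [← ENNReal.ofReal_ofNat 2]
    exact ENNReal.ofReal_le_ofReal (by linarith)
  have hsq : ∫ o, ((o.1 - muX (L n) o.2.2) * (o.2.1 - muY (L n) o.2.2)) ^ 2
      ∂(L n : Measure (Obs (p n))) = productVar (L n) := by
    rw [productVar, integral_eq_lintegral_of_nonneg_ae (.of_forall fun _ => sq_nonneg _)
      (hmeas.pow_const 2).aestronglyMeasurable]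
    simp_rw [mul_pow]
  refine hclt (fun _ => (L n : Measure (Obs (p n)))) (fun _ o => a *
    ((o.1 - muX (L n) o.2.2) * (o.2.1 - muY (L n) o.2.2))) (fun _ => hmeas.const_mul a)
    (fun _ => ?_) ?_ ?_
  · rw [integral_const_mul,
      integral_resX_mul_resY hnulln hfinn (hL2.integrable (by norm_num)), mul_zero]
  · simp_rw [mul_pow a]
    rw [integral_const_mul, hsq, Finset.sum_const, Finset.card_univ, Fintype.card_fin,
      nsmul_eq_mul, ha, inv_pow, mul_pow, Real.sq_sqrt hn0.le, Real.sq_sqrt hσ.le]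
    have : (n : ℝ) * (((n : ℝ) * productVar (L n))⁻¹ * productVar (L n)) = 1 := by field_simp
    rw [this, sub_self, abs_zero]
    exact hκ.le
  · refine le_trans ?_ hn
    simp_rw [enorm_mul a, ENNReal.mul_rpow_of_nonneg _ _ (by linarith : 0 ≤ 2 + δ)]
    rw [lintegral_const_mul _ (by fun_prop), Finset.sum_const, Finset.card_univ, Fintype.card_fin,
      nsmul_eq_mul, Real.enorm_of_nonneg ha0.le, ENNReal.ofReal_rpow_of_nonneg ha0.le (by linarith)]
    refine (mul_le_mul_right (mul_le_mul_right hmn _) _).trans ?_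
    rw [← ENNReal.ofReal_natCast, ← ENNReal.ofReal_mul (by positivity),
      ← ENNReal.ofReal_mul (by positivity)]
    refine ENNReal.ofReal_le_ofReal ?_
    have h1 : a ≤ (√(n : ℝ))⁻¹ * (√c₁)⁻¹ := by
      rw [ha, mul_inv]
      have := hmom.pos₁
      have := hmom.le_productVar n hn1
      gcongr
    have h2 : a ^ (2 + δ) ≤ ((√(n : ℝ))⁻¹ * (√c₁)⁻¹) ^ (2 + δ) := by gcongr
    have h3 : (√(n : ℝ))⁻¹ ^ (2 + δ) = (n : ℝ)⁻¹ * (n : ℝ) ^ (-(δ / 2)) := by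
      rw [Real.sqrt_eq_rpow, ← Real.rpow_neg hn0.le, ← Real.rpow_mul hn0.le,
        ← Real.rpow_neg_one, ← Real.rpow_add hn0]
      congr 1; ring
    rw [Real.mul_rpow (by positivity) (by positivity), h3] at h2
    have := hmom.pos₂
    calc (n : ℝ) * (a ^ (2 + δ) * c₂)
        ≤ n * (((n : ℝ)⁻¹ * (n : ℝ) ^ (-(δ / 2)) * (√c₁)⁻¹ ^ (2 + δ)) * c₂) := by gcongr
      _ = _ := by field_simp

/-! ### Consistency of the resampling variance -/

/-- Law of large numbers for the products of the true conditional variances. -/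
lemma tendstoZero_sum_var_mul_var {c₁ c₂ δ : ℝ} (hmom : UniformMoments L c₁ c₂ δ)
    (hl : l ≤ atTop) (hnull : ∀ᶠ n in l, L n ∈ nullLaws (p n))
    (hfin : ∀ᶠ n in l, FiniteCondVar (L n)) :
    TendstoZeroInProb l (fun n => sampleLaw n (L n)) fun n s =>
      ‖∑ i, (n : ℝ)⁻¹ * (var (lawX (L n) (s i).2.2) * var (lawY (L n) (s i).2.2)) -
        productVar (L n)‖ₑ := by
  have hδ := hmom.pos
  have hvm (n : ℕ) : Measurable fun o : Obs (p n) =>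
      var (lawX (L n) o.2.2) * var (lawY (L n) o.2.2) := by
    have h1 := measurable_var_kernel (lawX (L n))
    have h2 := measurable_var_kernel (lawY (L n))
    exact (h1.comp (by fun_prop)).mul (h2.comp (by fun_prop))
  refine TendstoZeroInProb.of_lintegral (fun n => ?_) ?_
  · refine Measurable.enorm (Measurable.sub (Finset.measurable_fun_sum _ fun i _ => ?_)
      measurable_const)
    exact ((hvm n).comp (measurable_pi_apply i)).const_mul _
  -- the truncation level `n ^ (-1/2)` makes both terms of the bound vanish
  have hlim : Tendsto (fun n : ℕ => ENNReal.ofReal √((1 + c₂) * (n : ℝ) ^ (-(1 / 2) : ℝ)) +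
      2 * ENNReal.ofReal (c₂ * (n : ℝ) ^ (-(δ / 4)))) atTop (𝓝 0) := by
    have h1 : Tendsto (fun n : ℕ => (1 + c₂) * (n : ℝ) ^ (-(1 / 2) : ℝ)) atTop (𝓝 0) := by
      simpa using ((tendsto_rpow_neg_atTop (y := 1 / 2) (by norm_num)).comp
        tendsto_natCast_atTop_atTop).const_mul (1 + c₂)
    have h2 := ENNReal.tendsto_ofReal ((Real.continuous_sqrt.tendsto 0).comp h1)
    rw [Real.sqrt_zero, ENNReal.ofReal_zero] at h2
    have h3 := ENNReal.Tendsto.const_mul (a := 2)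
      (tendsto_ofReal_rpow_neg (c := c₂) (q := δ / 4) (by positivity)) (.inr (by norm_num))
    simpa using h2.add h3
  refine tendsto_of_tendsto_of_tendsto_of_le_of_le' tendsto_const_nhds (hlim.mono_left hl)
    (.of_forall fun _ => zero_le) ?_
  filter_upwards [hnull, hfin, hl (eventually_ge_atTop 1)] with n hnulln hfinn hn1
  have hn0 : (0 : ℝ) < n := by exact_mod_cast hn1
  have hσ := hmom.productVar_pos hn1
  have hae : ∀ᵐ o ∂(L n : Measure (Obs (p n))),
      ENNReal.ofReal (var (lawX (L n) o.2.2) * var (lawY (L n) o.2.2)) =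
        evar (lawX (L n) o.2.2) * evar (lawY (L n) o.2.2) := by
    have h1 : ∀ᵐ o ∂(L n : Measure (Obs (p n))), evar (lawX (L n) o.2.2) < ∞ ∧
        evar (lawY (L n) o.2.2) < ∞ := ae_of_ae_map (by fun_prop) hfinn
    filter_upwards [h1] with o ho
    rw [ENNReal.ofReal_mul (var_nonneg _), ofReal_var ho.1, ofReal_var ho.2]
  have hv0 (o : Obs (p n)) : 0 ≤ var (lawX (L n) o.2.2) * var (lawY (L n) o.2.2) :=
    mul_nonneg (var_nonneg _) (var_nonneg _)
  have hlint : ∫⁻ o, ENNReal.ofReal (var (lawX (L n) o.2.2) * var (lawY (L n) o.2.2))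
      ∂(L n : Measure (Obs (p n))) = ENNReal.ofReal (productVar (L n)) := by
    rw [lintegral_congr_ae hae, ← lintegral_resX_sq_mul_resY_sq hnulln,
      hmom.ofReal_productVar n hn1]
  have hint : Integrable (fun o : Obs (p n) => var (lawX (L n) o.2.2) * var (lawY (L n) o.2.2))
      (L n : Measure (Obs (p n))) := by
    refine ⟨(hvm n).aestronglyMeasurable, ?_⟩
    rw [hasFiniteIntegral_iff_ofReal (.of_forall hv0), hlint]
    exact ENNReal.ofReal_lt_top
  have hmean : ∫ o, var (lawX (L n) o.2.2) * var (lawY (L n) o.2.2) ∂(L n : Measure (Obs (p n))) =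
      productVar (L n) := by
    rw [integral_eq_lintegral_of_nonneg_ae (.of_forall hv0) (hvm n).aestronglyMeasurable, hlint,
      ENNReal.toReal_ofReal hσ.le]
  have hmom' : ∫⁻ o, ‖var (lawX (L n) o.2.2) * var (lawY (L n) o.2.2)‖ₑ ^ (1 + δ / 2)
      ∂(L n : Measure (Obs (p n))) ≤ ENNReal.ofReal c₂ := by
    refine le_trans (le_of_eq (lintegral_congr_ae ?_))
      ((lintegral_evar_mul_evar_rpow_le hnulln hδ).trans (hmom.moment_le n hn1))
    filter_upwards [hae] with o ho
    rw [Real.enorm_of_nonneg (hv0 o), ho]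
  have hwlln := lintegral_enorm_sum_sub_le (fun _ : Fin n => (L n : Measure (Obs (p n))))
    (w := fun _ o => (n : ℝ)⁻¹ * (var (lawX (L n) o.2.2) * var (lawY (L n) o.2.2)))
    (fun _ => (hvm n).const_mul _) (fun _ o => mul_nonneg (by positivity) (hv0 o))
    (fun _ => hint.const_mul _) (θ := δ / 2) (r := (n : ℝ) ^ (-(1 / 2) : ℝ)) (half_pos hδ)
    (by positivity)
  have hsum : ∑ _i : Fin n, ∫ o, (n : ℝ)⁻¹ * (var (lawX (L n) o.2.2) * var (lawY (L n) o.2.2))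
      ∂(L n : Measure (Obs (p n))) = productVar (L n) := by
    rw [Finset.sum_const, Finset.card_univ, Fintype.card_fin, nsmul_eq_mul, integral_const_mul,
      hmean]
    field_simp
  rw [hsum] at hwlln
  refine hwlln.trans (add_le_add (ENNReal.ofReal_le_ofReal (Real.sqrt_le_sqrt ?_))
    (mul_le_mul_right ?_ 2))
  · rw [mul_comm]
    have := hmom.productVar_le n hn1
    gcongr
  · simp_rw [enorm_mul (n : ℝ)⁻¹, ENNReal.mul_rpow_of_nonneg _ _ (by linarith : 0 ≤ 1 + δ / 2)]
    rw [lintegral_const_mul _ (by have := hvm n; fun_prop), Finset.sum_const, Finset.card_univ,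
      Fintype.card_fin, nsmul_eq_mul, Real.enorm_of_nonneg (by positivity),
      ENNReal.ofReal_rpow_of_nonneg (by positivity) (by linarith)]
    refine (mul_le_mul_right (mul_le_mul_right (mul_le_mul_right hmom' _) _) _).trans ?_
    rw [← ENNReal.ofReal_natCast, ← ENNReal.ofReal_mul (by positivity),
      ← ENNReal.ofReal_mul (by positivity), ← ENNReal.ofReal_mul (by positivity)]
    refine ENNReal.ofReal_le_ofReal (le_of_eq ?_)
    rw [← Real.rpow_mul hn0.le, ← Real.rpow_neg_one, ← Real.rpow_mul hn0.le]
    have h : (n : ℝ) ^ (-(1 / 2) * -(δ / 2)) * ((n : ℝ) * (n : ℝ) ^ (-1 * (1 + δ / 2))) =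
        (n : ℝ) ^ (-(δ / 4)) := by
      nth_rewrite 2 [← Real.rpow_one (n : ℝ)]
      rw [← Real.rpow_add hn0, ← Real.rpow_add hn0]
      congr 1; ring
    rw [← h]; ring

end Sequences

section Resampling

variable {p : ℕ → ℕ} {L : ∀ n, ProbabilityMeasure (Obs (p n))}
  {lawHat : ∀ n, Kernel (FitData n (p n) × Cov (p n)) ℝ}
  {muYHat : ∀ n, FitData n (p n) × Cov (p n) → ℝ} {l : Filter ℕ}

lemma integrable_sub_mean_sq {ν : Measure ℝ} [IsProbabilityMeasure ν] (h : evar ν < ∞) :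
    Integrable (fun x => (x - mean ν) ^ 2) ν := by
  have hid : MemLp (fun x : ℝ => x) 2 ν :=
    (evariance_lt_top_iff_memLp aestronglyMeasurable_id).1 h
  exact (hid.sub (memLp_const _)).integrable_sq

lemma integral_sub_mean_sq (ν : Measure ℝ) : ∫ x, (x - mean ν) ^ 2 ∂ν = var ν :=
  (variance_eq_integral aemeasurable_id).symm

/-- The conditional Lyapunov ratio in which the moments of the learned laws are weighted by `u`. -/
noncomputable def lyapunovRatio {n q : ℕ} (lawHat : Kernel (FitData n q × Cov q) ℝ) (δ : ℝ)
    (u : Fin n → ℝ≥0∞) (s : Sample n q) : ℝ≥0∞ :=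
  (∑ i, u i * ∫⁻ x, ‖x - hatMuX lawHat s i‖ₑ ^ (2 + δ) ∂(hatLaw lawHat s i)) /
    (n : ℝ≥0∞) ^ (1 + δ / 2)

/-- The conditional mean, given `X` and `Z`, of the error made by replacing the squared residuals of
`Y` with the conditional variances in the resampling variance. -/
lemma lintegral_sum_var_hatLaw_sub_le {n q : ℕ} {L : ProbabilityMeasure (Obs q)}
    {lawHat : Kernel (FitData n q × Cov q) ℝ} [IsMarkovKernel lawHat] (hn : 1 ≤ n) {δ r : ℝ}
    (hδ : 0 < δ) (hr : 0 < r) {s : Sample n q} (hs : ∀ i, evar (lawY L (s i).2.2) < ∞) :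
    ∫⁻ y, ‖∑ i, (n : ℝ)⁻¹ * var (hatLaw lawHat s i) * (y i - muY L (s i).2.2) ^ 2 -
        ∑ i, (n : ℝ)⁻¹ * var (hatLaw lawHat s i) * var (lawY L (s i).2.2)‖ₑ
        ∂(Measure.pi fun i => lawY L (s i).2.2) ≤
      ENNReal.ofReal √(r * ∑ i, (n : ℝ)⁻¹ * var (hatLaw lawHat s i) * var (lawY L (s i).2.2)) +
        2 * (ENNReal.ofReal (r ^ (-(δ / 2))) * lyapunovRatio lawHat δ
          (fun i => ∫⁻ y, ‖y - muY L (s i).2.2‖ₑ ^ (2 + δ) ∂(lawY L (s i).2.2)) s) := by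
  have hn0 : (0 : ℝ) < n := by exact_mod_cast hn
  have h := lintegral_enorm_sum_sub_le (fun i => lawY L (s i).2.2)
    (w := fun i y => (n : ℝ)⁻¹ * var (hatLaw lawHat s i) * (y - muY L (s i).2.2) ^ 2)
    (fun i => by fun_prop)
    (fun i y => mul_nonneg (mul_nonneg (by positivity) (var_nonneg _)) (sq_nonneg _))
    (fun i => (integrable_sub_mean_sq (hs i)).const_mul _) (half_pos hδ) hr
  have hmean (i : Fin n) : ∫ y, (n : ℝ)⁻¹ * var (hatLaw lawHat s i) * (y - muY L (s i).2.2) ^ 2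
      ∂(lawY L (s i).2.2) = (n : ℝ)⁻¹ * var (hatLaw lawHat s i) * var (lawY L (s i).2.2) := by
    rw [integral_const_mul, ← integral_sub_mean_sq (lawY L (s i).2.2)]
    rfl
  simp only [hmean] at h
  refine h.trans (add_le_add_right (mul_le_mul_right (mul_le_mul_right ?_ _) _) _)
  rw [lyapunovRatio, ENNReal.div_eq_inv_mul, Finset.mul_sum]
  refine Finset.sum_le_sum fun i _ => ?_
  have hpow (y : ℝ) : ‖(n : ℝ)⁻¹ * var (hatLaw lawHat s i) * (y - muY L (s i).2.2) ^ 2‖ₑ ^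
      (1 + δ / 2) = ‖(n : ℝ)⁻¹ * var (hatLaw lawHat s i)‖ₑ ^ (1 + δ / 2) *
        ‖y - muY L (s i).2.2‖ₑ ^ (2 + δ) := by
    rw [enorm_mul, ENNReal.mul_rpow_of_nonneg _ _ (by linarith), enorm_pow, ← ENNReal.rpow_ofNat,
      ← ENNReal.rpow_mul]
    congr 2
    ring
  simp_rw [hpow]
  rw [lintegral_const_mul _ (by fun_prop), mul_comm, mul_left_comm]
  refine mul_le_mul_right ?_ _
  have h1 : ‖(n : ℝ)⁻¹‖ₑ = (n : ℝ≥0∞)⁻¹ := by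
    rw [Real.enorm_of_nonneg (by positivity), ENNReal.ofReal_inv_of_pos hn0, ENNReal.ofReal_natCast]
  rw [enorm_mul, ENNReal.mul_rpow_of_nonneg _ _ (by linarith), h1, ENNReal.inv_rpow]
  refine mul_le_mul_right ?_ _
  refine le_trans (ENNReal.rpow_le_rpow ?_ (by linarith)) (evar_rpow_le (hatLaw lawHat s i) hδ)
  rw [Real.enorm_of_nonneg (var_nonneg _)]
  exact ENNReal.ofReal_toReal_le

lemma exists_truncation_level {C ε θ : ℝ} (hC : 0 < C) (hε : 0 < ε) :
    ∃ r κ : ℝ, 0 < r ∧ 0 < κ ∧ κ ≤ 1 ∧ √(r * C) + 2 * (r ^ (-θ) * κ) ≤ ε := by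
  set r := (ε / 2) ^ 2 / C with hr
  have hr0 : 0 < r := by positivity
  refine ⟨r, min 1 (ε / 4 / r ^ (-θ)), hr0, by positivity, min_le_left _ _, ?_⟩
  have h1 : √(r * C) = ε / 2 := by
    rw [hr, div_mul_cancel₀ _ hC.ne', Real.sqrt_sq (by positivity)]
  have h2 : r ^ (-θ) * min 1 (ε / 4 / r ^ (-θ)) ≤ ε / 4 :=
    (mul_le_mul_of_nonneg_left (min_le_right _ _) (by positivity)).trans_eq (by field_simp)
  linarith

/-- The conditional variance of the resampled statistic with the true residuals of `Y` is
consistent. -/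
theorem tendstoZero_sum_var_hatLaw_mul_resY_sq [∀ n, IsMarkovKernel (lawHat n)]
    {c₁ c₂ δ δ' : ℝ} (hmom : UniformMoments L c₁ c₂ δ') (hδ : 0 < δ) (hl : l ≤ atTop)
    (hnull : ∀ᶠ n in l, L n ∈ nullLaws (p n)) (hfin : ∀ᶠ n in l, FiniteCondVar (L n))
    (hlyap : TendstoZeroInProb l (fun n => sampleLaw n (L n)) fun n s =>
      lyapunovRatio (lawHat n) δ (fun i =>
        ∫⁻ y, ‖y - muY (L n) (s i).2.2‖ₑ ^ (2 + δ) ∂(lawY (L n) (s i).2.2)) s)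
    (hvar : VarianceConsistent lawHat L) :
    TendstoZeroInProb l (fun n => sampleLaw n (L n)) fun n s =>
      ‖∑ i, (n : ℝ)⁻¹ * var (hatLaw (lawHat n) s i) * ((s i).2.1 - muY (L n) (s i).2.2) ^ 2 -
        productVar (L n)‖ₑ := by
  -- with the conditional variances of `Y` in place of the squared residuals
  have hA : TendstoZeroInProb l (fun n => sampleLaw n (L n)) fun n s =>
      ‖∑ i, (n : ℝ)⁻¹ * var (hatLaw (lawHat n) s i) * var (lawY (L n) (s i).2.2) -
        productVar (L n)‖ₑ := by
    have h1 : TendstoZeroInProb l (fun n => sampleLaw n (L n)) fun n s =>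
        ‖(n : ℝ)⁻¹ * ∑ i, (var (hatLaw (lawHat n) s i) - var (lawX (L n) (s i).2.2)) *
          var (lawY (L n) (s i).2.2)‖ₑ := fun ε hε => (hvar ε hε).mono_left hl
    refine (h1.add (tendstoZero_sum_var_mul_var hmom hl hnull hfin)).of_le
      (.of_forall fun n => .of_forall fun s => ?_)
    refine le_trans (le_of_eq ?_) (enorm_add_le _ _)
    congr 1
    rw [Finset.mul_sum, ← add_sub_assoc, ← Finset.sum_add_distrib]
    congr 1
    refine Finset.sum_congr rfl fun i _ => ?_
    ring
  have hB : TendstoZeroInProb l (fun n => sampleLaw n (L n)) fun n s =>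
      ‖∑ i, (n : ℝ)⁻¹ * var (hatLaw (lawHat n) s i) * ((s i).2.1 - muY (L n) (s i).2.2) ^ 2 -
        ∑ i, (n : ℝ)⁻¹ * var (hatLaw (lawHat n) s i) * var (lawY (L n) (s i).2.2)‖ₑ := by
    refine TendstoZeroInProb.of_cond (fun n s => Measure.pi fun i => lawY (L n) (s i).2.2)
      (fun n => replaceY) (fun n s => measurable_replaceY s)
      (hnull.mono fun n hn F hF => lintegral_replaceY hn hF) (fun n => ?_)
      (.of_forall fun n => .of_forall fun s => le_rfl) ?_
    · have h1 := measurable_var_hatLaw (lawHat n)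
      have h2 := measurable_muY (L n)
      have h3 (i : Fin n) : Measurable fun s : Sample n (p n) => var (lawY (L n) (s i).2.2) :=
        (measurable_var_kernel (lawY (L n))).comp (by fun_prop)
      fun_prop
    have hc₂ := hmom.pos₂
    refine hA.of_imp₂ hlyap fun ε hε => ?_
    obtain ⟨r, κ, hr, hκ, hκ1, hle⟩ :=
      exists_truncation_level (C := 2 + c₂) (θ := δ / 2) (by positivity) hε
    refine ⟨κ, hκ, ?_⟩
    filter_upwards [hfin, hl (eventually_ge_atTop 1)] with n hfinn hn1
    filter_upwards [hfinn.ae_sample] with s hs h1 h2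
    refine (lintegral_sum_var_hatLaw_sub_le (lawHat := lawHat n) hn1 hδ hr
      fun i => (hs i).2).trans ?_
    rw [Real.enorm_eq_ofReal_abs, ENNReal.ofReal_le_ofReal_iff hκ.le] at h1
    have h3 := (abs_le.1 h1).2
    have h4 := hmom.productVar_le n hn1
    calc _ ≤ ENNReal.ofReal √(r * (2 + c₂)) +
          2 * (ENNReal.ofReal (r ^ (-(δ / 2))) * ENNReal.ofReal κ) := by
          refine add_le_add (ENNReal.ofReal_le_ofReal (Real.sqrt_le_sqrt
            (mul_le_mul_of_nonneg_left ?_ hr.le))) ?_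
          · linarith
          · gcongr
      _ = ENNReal.ofReal (√(r * (2 + c₂)) + 2 * (r ^ (-(δ / 2)) * κ)) := by
          rw [ENNReal.ofReal_add (by positivity) (by positivity), ENNReal.ofReal_mul (by norm_num),
            ENNReal.ofReal_mul (by positivity), ENNReal.ofReal_ofNat]
      _ ≤ _ := ENNReal.ofReal_le_ofReal hle
  refine (hB.add hA).of_le (.of_forall fun n => .of_forall fun s => ?_)
  refine le_trans (le_of_eq ?_) (enorm_add_le _ _)
  congr 1
  ring

/-- The Lyapunov condition passes from the conditional moments of `Y` to the realized residuals, by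
the conditional Markov inequality. -/
lemma tendstoZero_lyapunovRatio_resY [∀ n, IsMarkovKernel (lawHat n)] {δ : ℝ}
    (hnull : ∀ᶠ n in l, L n ∈ nullLaws (p n))
    (hlyap : TendstoZeroInProb l (fun n => sampleLaw n (L n)) fun n s =>
      lyapunovRatio (lawHat n) δ (fun i =>
        ∫⁻ y, ‖y - muY (L n) (s i).2.2‖ₑ ^ (2 + δ) ∂(lawY (L n) (s i).2.2)) s) :
    TendstoZeroInProb l (fun n => sampleLaw n (L n)) fun n s =>
      lyapunovRatio (lawHat n) δ (fun i => ‖(s i).2.1 - muY (L n) (s i).2.2‖ₑ ^ (2 + δ)) s := by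
  refine TendstoZeroInProb.of_cond (fun n s => Measure.pi fun i => lawY (L n) (s i).2.2)
    (fun n => replaceY) (fun n s => measurable_replaceY s)
    (hnull.mono fun n hn F hF => lintegral_replaceY hn hF) (fun n => ?_)
    (.of_forall fun n => .of_forall fun s => le_of_eq ?_) hlyap
  · have h1 (i : Fin n) := measurable_moment_hatLaw (lawHat n) i (2 + δ)
    have h2 := measurable_muY (L n)
    unfold lyapunovRatio
    fun_prop
  · change ∫⁻ y, (∑ i, ‖y i - muY (L n) (s i).2.2‖ₑ ^ (2 + δ) * ∫⁻ x,
      ‖x - hatMuX (lawHat n) s i‖ₑ ^ (2 + δ) ∂(hatLaw (lawHat n) s i)) /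
        (n : ℝ≥0∞) ^ (1 + δ / 2) ∂(Measure.pi fun i => lawY (L n) (s i).2.2) = _
    simp_rw [lyapunovRatio, div_eq_mul_inv]
    rw [lintegral_mul_const _ (by fun_prop), lintegral_finsetSum _ fun i _ => by fun_prop]
    congr 1
    refine Finset.sum_congr rfl fun i _ => ?_
    rw [lintegral_mul_const _ (by fun_prop)]
    congr 1
    exact (measurePreserving_eval (fun i => lawY (L n) (s i).2.2) i).lintegral_comp
      (f := fun y => ‖y - muY (L n) (s i).2.2‖ₑ ^ (2 + δ)) (by fun_prop)

/-! ### Limit law of the resampled statistic -/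

/-- The central limit theorem for the resampled statistic with the true residuals of `Y`, on the
event that its conditional variance and Lyapunov ratio are close to their limits. -/
theorem exists_resampling_bound [∀ n, IsMarkovKernel (lawHat n)]
    {c₁ c₂ δ δ' : ℝ} (hmom : UniformMoments L c₁ c₂ δ') (hδ : 0 < δ) {F : Set ℝ}
    (hF : IsClosed F) {ε : ℝ≥0∞} (hε : 0 < ε) :
    ∃ κ : ℝ, 0 < κ ∧ ∀ n, 1 ≤ n → ∀ s : Sample n (p n),
      (∀ i, evar (hatLaw (lawHat n) s i) < ∞) →
      ‖∑ i, (n : ℝ)⁻¹ * var (hatLaw (lawHat n) s i) * ((s i).2.1 - muY (L n) (s i).2.2) ^ 2 -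
        productVar (L n)‖ₑ ≤ ENNReal.ofReal κ →
      lyapunovRatio (lawHat n) δ (fun i => ‖(s i).2.1 - muY (L n) (s i).2.2‖ₑ ^ (2 + δ)) s ≤
        ENNReal.ofReal κ →
      Measure.pi (fun i => hatLaw (lawHat n) s i) {x | ∑ i, (√(n : ℝ) * √(productVar (L n)))⁻¹ *
        ((s i).2.1 - muY (L n) (s i).2.2) * (x i - hatMuX (lawHat n) s i) ∈ F} ≤
      gaussianReal 0 1 F + ε := by
  obtain ⟨κ, hκ, hclt⟩ := exists_lyapunov_bound hF hε hδ
  have hc₁ := hmom.pos₁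
  refine ⟨min (κ * c₁) (κ * √c₁ ^ (2 + δ)), by positivity, fun n hn s hs hv hm => ?_⟩
  have hn0 : (0 : ℝ) < n := by exact_mod_cast hn
  have hσ := hmom.productVar_pos hn
  have hcσ := hmom.le_productVar n hn
  refine hclt (fun i => hatLaw (lawHat n) s i) (fun i x => (√(n : ℝ) * √(productVar (L n)))⁻¹ *
    ((s i).2.1 - muY (L n) (s i).2.2) * (x - hatMuX (lawHat n) s i)) (fun i => by fun_prop)
    (fun i => ?_) ?_ ?_
  · rw [integral_const_mul]
    exact mul_eq_zero_of_right _ (integral_sub_mean (hs i))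
  · have h1 (i : Fin n) : ∫ x, ((√(n : ℝ) * √(productVar (L n)))⁻¹ *
        ((s i).2.1 - muY (L n) (s i).2.2) * (x - hatMuX (lawHat n) s i)) ^ 2
          ∂(hatLaw (lawHat n) s i) = (productVar (L n))⁻¹ * ((n : ℝ)⁻¹ *
            var (hatLaw (lawHat n) s i) * ((s i).2.1 - muY (L n) (s i).2.2) ^ 2) := by
      simp_rw [mul_pow]
      rw [integral_const_mul]
      have : ∫ x, (x - hatMuX (lawHat n) s i) ^ 2 ∂(hatLaw (lawHat n) s i) =
        var (hatLaw (lawHat n) s i) := integral_sub_mean_sq _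
      rw [this, inv_pow, mul_pow, Real.sq_sqrt hn0.le, Real.sq_sqrt hσ.le, mul_inv]
      ring
    simp_rw [h1]
    rw [← Finset.mul_sum]
    rw [Real.enorm_eq_ofReal_abs, ENNReal.ofReal_le_ofReal_iff (by positivity)] at hv
    have h2 := hv.trans (min_le_left _ _)
    set S := ∑ i, (n : ℝ)⁻¹ * var (hatLaw (lawHat n) s i) *
      ((s i).2.1 - muY (L n) (s i).2.2) ^ 2
    rw [show (productVar (L n))⁻¹ * S - 1 = (S - productVar (L n)) / productVar (L n) by
      field_simp, abs_div, abs_of_pos hσ, div_le_iff₀ hσ]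
    exact h2.trans (by gcongr)
  · have hq : 0 ≤ 2 + δ := by linarith
    have h1 (i : Fin n) : ∫⁻ x, ‖(√(n : ℝ) * √(productVar (L n)))⁻¹ *
        ((s i).2.1 - muY (L n) (s i).2.2) * (x - hatMuX (lawHat n) s i)‖ₑ ^ (2 + δ)
          ∂(hatLaw (lawHat n) s i) = ‖(√(n : ℝ) * √(productVar (L n)))⁻¹‖ₑ ^ (2 + δ) *
            (‖(s i).2.1 - muY (L n) (s i).2.2‖ₑ ^ (2 + δ) *
              ∫⁻ x, ‖x - hatMuX (lawHat n) s i‖ₑ ^ (2 + δ) ∂(hatLaw (lawHat n) s i)) := by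
      simp_rw [enorm_mul, ENNReal.mul_rpow_of_nonneg _ _ hq]
      rw [lintegral_const_mul _ (by fun_prop), mul_assoc]
    simp_rw [h1]
    rw [← Finset.mul_sum]
    have h2 : ‖(√(n : ℝ) * √(productVar (L n)))⁻¹‖ₑ ^ (2 + δ) =
        ENNReal.ofReal ((√(productVar (L n)) ^ (2 + δ))⁻¹) * ((n : ℝ≥0∞) ^ (1 + δ / 2))⁻¹ := by
      rw [Real.enorm_of_nonneg (by positivity), ENNReal.ofReal_rpow_of_nonneg (by positivity) hq,
        ← ENNReal.ofReal_natCast, ENNReal.ofReal_rpow_of_nonneg hn0.le (by linarith),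
        ← ENNReal.ofReal_inv_of_pos (by positivity), ← ENNReal.ofReal_mul (by positivity)]
      congr 1
      rw [Real.inv_rpow (by positivity), Real.mul_rpow (by positivity) (by positivity), mul_inv,
        mul_comm]
      congr 2
      rw [Real.sqrt_eq_rpow, ← Real.rpow_mul hn0.le]
      congr 1; ring
    rw [h2, mul_assoc, mul_comm (_⁻¹ : ℝ≥0∞), ← div_eq_mul_inv]
    refine (mul_le_mul_right hm _).trans ?_
    rw [← ENNReal.ofReal_mul (by positivity)]
    refine ENNReal.ofReal_le_ofReal ?_
    have h3 : √c₁ ^ (2 + δ) ≤ √(productVar (L n)) ^ (2 + δ) := by gcongr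
    have h4 : (0 : ℝ) < √(productVar (L n)) ^ (2 + δ) := by positivity
    rw [inv_mul_le_iff₀ h4]
    refine (min_le_right _ _).trans ?_
    rw [mul_comm]
    gcongr

lemma le_quantile {ν : Measure ℝ} [IsProbabilityMeasure ν] {a t : ℝ} (ha : a < 1)
    (h : ν (Set.Iic t) < ENNReal.ofReal a) : t ≤ quantile ν a := by
  refine le_csInf ?_ fun u hu => ?_
  · have h1 : Tendsto (fun u => ν (Set.Iic u)) atTop (𝓝 1) := by
      simpa using tendsto_measure_Iic_atTop ν
    have h2 : ENNReal.ofReal a < 1 := by rwa [ENNReal.ofReal_lt_one]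
    obtain ⟨u, hu⟩ := (h1.eventually_const_lt h2).exists
    exact ⟨u, hu.le⟩
  · by_contra hlt
    exact (h.trans_le hu).not_ge (measure_mono (Set.Iic_subset_Iic.2 (not_le.1 hlt).le))

/-- Chebyshev's inequality for the part of the resampled statistic that comes from the error of the
regression of `Y`. -/
lemma measure_hatLaw_sum_errY_le {n q : ℕ} {L : ProbabilityMeasure (Obs q)}
    {lawHat : Kernel (FitData n q × Cov q) ℝ} [IsMarkovKernel lawHat]
    {muYHat : FitData n q × Cov q → ℝ} {s : Sample n q}
    (hs : ∀ i, evar (hatLaw lawHat s i) < ∞) {ρ : ℝ} (hρ : 0 < ρ) :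
    Measure.pi (fun i => hatLaw lawHat s i) {x | ENNReal.ofReal ρ ≤
        ‖∑ i, (√(n : ℝ))⁻¹ * (hatMuY muYHat s i - muY L (s i).2.2) *
          (x i - hatMuX lawHat s i)‖ₑ} ≤
      ‖hatErrY' L lawHat muYHat s‖ₑ ^ 2 / ENNReal.ofReal ρ ^ 2 := by
  have h := lintegral_sq_sum_mul_sub_mean (fun i => hatLaw lawHat s i) hs fun i =>
    (√(n : ℝ))⁻¹ * (hatMuY muYHat s i - muY L (s i).2.2)
  have h2 : ENNReal.ofReal (∑ i, ((√(n : ℝ))⁻¹ * (hatMuY muYHat s i - muY L (s i).2.2)) ^ 2 *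
      var (hatLaw lawHat s i)) = ‖hatErrY' L lawHat muYHat s‖ₑ ^ 2 := by
    rw [hatErrY', enorm_sqrt_sq (mul_nonneg (by positivity) (Finset.sum_nonneg fun i _ =>
      mul_nonneg (sq_nonneg _) (var_nonneg _))), Finset.mul_sum]
    congr 1
    refine Finset.sum_congr rfl fun i _ => ?_
    rw [mul_pow, inv_pow, Real.sq_sqrt (Nat.cast_nonneg n)]
    ring
  rw [← h2, ← h]
  refine le_trans (measure_mono (Set.ofPred_subset_ofPred.2 fun x hx => ?_))
    (meas_ge_le_lintegral_div ?_ ?_ ?_)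
  · exact pow_le_pow_left' hx 2
  · refine Measurable.aemeasurable ?_
    unfold mean
    fun_prop
  · simpa using hρ
  · simp

lemma measurable_resampledStat {n q : ℕ} (lawHat : Kernel (FitData n q × Cov q) ℝ)
    (muYHat : FitData n q × Cov q → ℝ) (s : Sample n q) :
    Measurable (resampledStat lawHat muYHat s) := by
  unfold resampledStat
  fun_prop

/-- The resampling quantile exceeds, with probability tending to one, the normal quantiles of lower
level on the scale of the limit law of the statistic. -/
theorem tendsto_sampleLaw_quantile_lt [∀ n, IsMarkovKernel (lawHat n)]
    {c₁ c₂ δ' : ℝ} (hmom : UniformMoments L c₁ c₂ δ') (hl : l ≤ atTop)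
    (hnull : ∀ᶠ n in l, L n ∈ nullLaws (p n)) (hfin : ∀ᶠ n in l, FiniteCondVar (L n))
    (hndg : Nondegenerate lawHat muYHat L) (hlyap : Lyapunov lawHat L)
    (herr : ErrorRates lawHat muYHat L) (hvar : VarianceConsistent lawHat L)
    {α b z : ℝ} (hα : 0 < α)
    (hb : gaussianReal 0 1 (Set.Iic b) < ENNReal.ofReal (1 - α)) (hz : z < b) :
    Tendsto (fun n => sampleLaw n (L n) {s | quantile (resampledLaw (lawHat n) (muYHat n) s)
      (1 - α) < √(productVar (L n)) * z}) l (𝓝 0) := by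
  obtain ⟨δ, hδ, hlyap'⟩ := hlyap
  have hlyap : TendstoZeroInProb l (fun n => sampleLaw n (L n)) fun n s =>
      lyapunovRatio (lawHat n) δ (fun i =>
        ∫⁻ y, ‖y - muY (L n) (s i).2.2‖ₑ ^ (2 + δ) ∂(lawY (L n) (s i).2.2)) s :=
    fun ε hε => (hlyap' ε hε).mono_left hl
  have h1 := tendstoZero_sum_var_hatLaw_mul_resY_sq hmom hδ hl hnull hfin hlyap hvar
  have h2 := tendstoZero_lyapunovRatio_resY hnull hlyap
  have h3 : TendstoZeroInProb l (fun n => sampleLaw n (L n)) fun n s =>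
      ‖hatErrY' (L n) (lawHat n) (muYHat n) s‖ₑ := fun ε hε => (herr.2.2.2 ε hε).mono_left hl
  have hc₁ := hmom.pos₁
  -- split the gap between the two probabilities in two halves
  obtain ⟨ε, hε, hgap⟩ : ∃ ε : ℝ, 0 < ε ∧ gaussianReal 0 1 (Set.Iic b) + ENNReal.ofReal ε +
      ENNReal.ofReal ε < ENNReal.ofReal (1 - α) := by
    have ht : Tendsto (fun ε : ℝ => gaussianReal 0 1 (Set.Iic b) + ENNReal.ofReal ε +
        ENNReal.ofReal ε) (𝓝[>] 0) (𝓝 (gaussianReal 0 1 (Set.Iic b))) := by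
      have h : Tendsto (fun ε : ℝ => ENNReal.ofReal ε) (𝓝[>] 0) (𝓝 0) := by
        simpa using (ENNReal.continuous_ofReal.tendsto 0).mono_left nhdsWithin_le_nhds
      simpa using (tendsto_const_nhds.add h).add h
    exact (eventually_mem_nhdsWithin.and (ht.eventually_lt_const hb)).exists
  obtain ⟨κ, hκ, hclt⟩ := exists_resampling_bound (lawHat := lawHat) hmom hδ
    (isClosed_Iic (a := b)) (ε := ENNReal.ofReal ε) (by simpa using hε)
  -- convergence of the indicator of the event makes the closure lemmas applicable
  have hV : TendstoZeroInProb l (fun n => sampleLaw n (L n)) fun n =>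
      {s | quantile (resampledLaw (lawHat n) (muYHat n) s) (1 - α) <
        √(productVar (L n)) * z}.indicator 1 := by
    refine ((h1.add h2).add h3).of_imp fun ε' hε' => ?_
    have hρ : 0 < √c₁ * (b - z) := mul_pos (by positivity) (by linarith)
    refine ⟨min κ (√ε * (√c₁ * (b - z))), by positivity, ?_⟩
    filter_upwards [hl (eventually_ge_atTop 1)] with n hn
    filter_upwards [ae_all_iff.2 (hndg n hn)] with s hs hsum
    have hn0 : (0 : ℝ) < n := by exact_mod_cast hn
    have hσ := hmom.productVar_pos hn
    have hσ' : 0 < √(productVar (L n)) := by positivity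
    have hρ' : √c₁ * (b - z) ≤ √(productVar (L n)) * (b - z) := by
      have := hmom.le_productVar n hn
      have : 0 ≤ b - z := by linarith
      gcongr
    have hρ0 : 0 < √(productVar (L n)) * (b - z) := hρ.trans_le hρ'
    have hsκ := hsum.trans (ENNReal.ofReal_le_ofReal (min_le_left _ _))
    have hA := hclt n hn s (fun i => (hs i).2.1) (le_self_add.trans (le_self_add.trans hsκ))
      (le_add_self.trans (le_self_add.trans hsκ))
    have hB : ‖hatErrY' (L n) (lawHat n) (muYHat n) s‖ₑ ^ 2 /
        ENNReal.ofReal (√(productVar (L n)) * (b - z)) ^ 2 ≤ ENNReal.ofReal ε := by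
      have h4 : ‖hatErrY' (L n) (lawHat n) (muYHat n) s‖ₑ ≤
          ENNReal.ofReal (√ε * (√(productVar (L n)) * (b - z))) :=
        (le_add_self.trans hsum).trans
          (ENNReal.ofReal_le_ofReal ((min_le_right _ _).trans (by gcongr)))
      refine ENNReal.div_le_of_le_mul ((pow_le_pow_left' h4 2).trans_eq ?_)
      rw [ENNReal.ofReal_mul (by positivity), mul_pow, ← ENNReal.ofReal_pow (Real.sqrt_nonneg ε),
        Real.sq_sqrt hε.le]
    have hlaw : resampledLaw (lawHat n) (muYHat n) s (Set.Iic (√(productVar (L n)) * z)) <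
        ENNReal.ofReal (1 - α) := by
      refine lt_of_le_of_lt ?_ hgap
      rw [resampledLaw, Measure.map_apply (measurable_resampledStat _ _ _) measurableSet_Iic]
      refine le_trans (measure_mono ?_) ((measure_union_le _ _).trans (add_le_add hA
        ((measure_hatLaw_sum_errY_le (L := L n) (muYHat := muYHat n)
          (fun i => (hs i).2.1) hρ0).trans hB)))
      intro x hx
      by_contra hcon
      simp only [Set.mem_union, Set.mem_ofPred_eq, Set.mem_Iic, not_or, not_le] at hcon
      obtain ⟨hc1, hc2⟩ := hcon
      rw [Real.enorm_eq_ofReal_abs, ENNReal.ofReal_lt_ofReal_iff hρ0] at hc2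
      have hx' : resampledStat (lawHat n) (muYHat n) s x ≤ √(productVar (L n)) * z := hx
      have hdec : resampledStat (lawHat n) (muYHat n) s x = √(productVar (L n)) *
          ∑ i, (√(n : ℝ) * √(productVar (L n)))⁻¹ * ((s i).2.1 - muY (L n) (s i).2.2) *
            (x i - hatMuX (lawHat n) s i) -
          ∑ i, (√(n : ℝ))⁻¹ * (hatMuY (muYHat n) s i - muY (L n) (s i).2.2) *
            (x i - hatMuX (lawHat n) s i) := by
        rw [resampledStat, Finset.mul_sum, Finset.mul_sum, ← Finset.sum_sub_distrib]
        refine Finset.sum_congr rfl fun i _ => ?_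
        rw [mul_inv]
        field_simp
        ring
      rw [hdec] at hx'
      have := mul_lt_mul_of_pos_left hc1 hσ'
      have := (abs_lt.1 hc2).2
      nlinarith
    have hprob : IsProbabilityMeasure (resampledLaw (lawHat n) (muYHat n) s) :=
      Measure.isProbabilityMeasure_map (measurable_resampledStat _ _ _).aemeasurable
    have hq := le_quantile (by linarith) hlaw
    rw [Set.indicator_of_notMem (by simpa using hq)]
    exact zero_le
  refine tendsto_of_tendsto_of_tendsto_of_le_of_le tendsto_const_nhds (hV (1 / 2) (by norm_num))
    (fun _ => zero_le) fun n => measure_mono (Set.ofPred_subset_ofPred.2 fun s hs => ?_)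
  beta_reduce
  rw [Set.indicator_of_mem (by exact hs), Pi.one_apply]
  exact ENNReal.ofReal_lt_one.2 (by norm_num)

end Resampling

/-! ### Asymptotic level of the test -/

lemma continuous_cdf (μ : Measure ℝ) [IsProbabilityMeasure μ] [NullSingletonClass μ] :
    Continuous (cdf μ) := by
  refine continuous_iff_continuousAt.2 fun x => ?_
  rw [(monotone_cdf μ).continuousAt_iff_leftLim_eq_rightLim, (cdf μ).rightLim_eq]
  refine le_antisymm ((monotone_cdf μ).leftLim_le le_rfl) ?_
  have h := (cdf μ).measure_singleton x
  rw [measure_cdf, measure_singleton, eq_comm, ENNReal.ofReal_eq_zero] at h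
  linarith

lemma exists_gaussianReal_quantiles {α ε : ℝ} (hα : α ∈ Set.Ioo (0 : ℝ) 1) (hε : 0 < ε) :
    ∃ a b : ℝ, a < b ∧ gaussianReal 0 1 (Set.Ici a) < ENNReal.ofReal (α + ε) ∧
      gaussianReal 0 1 (Set.Iic b) < ENNReal.ofReal (1 - α) := by
  obtain ⟨h0, h1⟩ := hα
  have : NullSingletonClass (gaussianReal 0 1) := nullSingletonClass_gaussianReal one_ne_zero
  set e := min ε (1 - α) with he
  have he0 : 0 < e := lt_min hε (by linarith)
  have heε : e ≤ ε := min_le_left _ _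
  have heα : e ≤ 1 - α := min_le_right _ _
  have hex (c : ℝ) (hc0 : 0 < c) (hc1 : c < 1) : ∃ t, cdf (gaussianReal 0 1) t = c :=
    mem_range_of_exists_le_of_exists_ge (continuous_cdf _)
      (((tendsto_cdf_atBot (gaussianReal 0 1)).eventually_le_const hc0).exists)
      (((tendsto_cdf_atTop (gaussianReal 0 1)).eventually_const_le hc1).exists)
  -- any two levels in `(1 - α - ε, 1 - α)` serve
  obtain ⟨a, ha⟩ := hex (1 - α - e / 2) (by linarith) (by linarith)
  obtain ⟨b, hb⟩ := hex (1 - α - e / 4) (by linarith) (by linarith)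
  refine ⟨a, b, ?_, ?_, ?_⟩
  · by_contra hab
    have := monotone_cdf (gaussianReal 0 1) (not_lt.1 hab)
    linarith
  · rw [← Set.compl_Iio, prob_compl_eq_one_sub measurableSet_Iio, measure_congr Iio_ae_eq_Iic,
      ← ofReal_cdf, ha, ← ENNReal.ofReal_one, ← ENNReal.ofReal_sub _ (by linarith)]
    exact (ENNReal.ofReal_lt_ofReal_iff (by linarith)).2 (by linarith)
  · rw [← ofReal_cdf, hb]
    exact (ENNReal.ofReal_lt_ofReal_iff (by linarith)).2 (by linarith)

/-- The asymptotic level of the test along a sequence of laws that are null along the filter `l`. -/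
theorem eventually_lintegral_test_le {p : ℕ → ℕ} {L : ∀ n, ProbabilityMeasure (Obs (p n))}
    {lawHat : ∀ n, Kernel (FitData n (p n) × Cov (p n)) ℝ} [∀ n, IsMarkovKernel (lawHat n)]
    {muYHat : ∀ n, FitData n (p n) × Cov (p n) → ℝ} (hmuYHat : ∀ n, Measurable (muYHat n))
    {l : Filter ℕ} (hl : l ≤ atTop) (hnull : ∀ᶠ n in l, L n ∈ nullLaws (p n))
    (hfin : ∀ᶠ n in l, FiniteCondVar (L n)) (hndg : Nondegenerate lawHat muYHat L)
    (hlyap : Lyapunov lawHat L) (herr : ErrorRates lawHat muYHat L) (hmb : MomentBounds L)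
    (hvar : VarianceConsistent lawHat L) {α ε : ℝ} (hα : α ∈ Set.Ioo (0 : ℝ) 1) (hε : 0 < ε) :
    ∀ᶠ n in l, ∫⁻ s, test α (lawHat n) (muYHat n) s ∂(sampleLaw n (L n)) ≤
      ENNReal.ofReal (α + ε) := by
  obtain ⟨c₁, c₂, δ, hmom⟩ := hmb.exists_uniformMoments
  have hc₁ := hmom.pos₁
  obtain ⟨a, b, hab, ha, hb⟩ := exists_gaussianReal_quantiles hα (half_pos hε)
  have hq := tendsto_sampleLaw_quantile_lt hmom hl hnull hfin hndg hlyap herr hvar hα.1 hb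
    (z := (a + b) / 2) (by linarith)
  have hR := tendstoZero_stat_sub hmuYHat hl hnull hfin herr (√c₁ * ((b - a) / 2))
    (mul_pos (by positivity) (by linarith))
  have hη : 0 < ENNReal.ofReal (ε / 6) := by simpa using hε
  filter_upwards [hl (eventually_ge_atTop 1), ENNReal.tendsto_nhds_zero.1 hq _ hη,
    ENNReal.tendsto_nhds_zero.1 hR _ hη,
    eventually_sampleLaw_sum_le hmom hl hnull hfin (isClosed_Ici (a := a)) hη] with n hn h1 h2 h3
  have hn0 : (0 : ℝ) < n := by exact_mod_cast hn
  have hσ := hmom.productVar_pos hn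
  have hσ' : 0 < √(productVar (L n)) := by positivity
  calc ∫⁻ s, test α (lawHat n) (muYHat n) s ∂(sampleLaw n (L n))
      ≤ sampleLaw n (L n) {s | quantile (resampledLaw (lawHat n) (muYHat n) s) (1 - α) <
          stat (lawHat n) (muYHat n) s} := lintegral_indicator_one_le _
    _ ≤ _ := measure_mono ?_
    _ ≤ _ := (measure_union_le _ _).trans
        (add_le_add (measure_union_le _ _) le_rfl) |>.trans (add_le_add (add_le_add h3 h1) h2)
    _ ≤ ENNReal.ofReal (α + ε / 2) + ENNReal.ofReal (ε / 6) + ENNReal.ofReal (ε / 6) +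
          ENNReal.ofReal (ε / 6) := by gcongr
    _ = ENNReal.ofReal (α + ε) := by
        have := hα.1
        rw [← ENNReal.ofReal_add (by linarith) (by linarith),
          ← ENNReal.ofReal_add (by linarith) (by linarith),
          ← ENNReal.ofReal_add (by linarith) (by linarith)]
        congr 1
        ring
  -- A statistic above its quantile, with the quantile above the midpoint of `a` and `b` and a small
  -- remainder, forces the normalized sum above `a`.
  intro s hs
  by_contra hcon
  simp only [Set.mem_union, Set.mem_ofPred_eq, Set.mem_Ici, not_or, not_lt, not_le] at hcon hs
  obtain ⟨⟨hc1, hc2⟩, hc3⟩ := hcon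
  have hρ : √c₁ * ((b - a) / 2) ≤ √(productVar (L n)) * ((b - a) / 2) := by
    have := hmom.le_productVar n hn
    have : 0 ≤ (b - a) / 2 := by linarith
    gcongr
  rw [Real.enorm_eq_ofReal_abs, ENNReal.ofReal_le_ofReal_iff
    (mul_nonneg (by positivity) (by linarith))] at hc3
  have hc4 := (le_abs_self _).trans (hc3.trans hρ)
  have hscale : ∑ i, (√(n : ℝ))⁻¹ * (((s i).1 - muX (L n) (s i).2.2) *
      ((s i).2.1 - muY (L n) (s i).2.2)) = √(productVar (L n)) *
      ∑ i, (√(n : ℝ) * √(productVar (L n)))⁻¹ * (((s i).1 - muX (L n) (s i).2.2) *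
        ((s i).2.1 - muY (L n) (s i).2.2)) := by
    rw [Finset.mul_sum]
    refine Finset.sum_congr rfl fun i _ => ?_
    rw [mul_inv]
    field_simp
  rw [hscale] at hc4
  have := mul_lt_mul_of_pos_left hc1 hσ'
  nlinarith

end DCRT

theorem corollary3 (α : ℝ) (hα : α ∈ Set.Ioo (0 : ℝ) 1) (p : ℕ → ℕ)
    (lawHat : ∀ n, Kernel (DCRT.FitData n (p n) × DCRT.Cov (p n)) ℝ)
    (hlawHat : ∀ n, IsMarkovKernel (lawHat n))
    (muYHat : ∀ n, DCRT.FitData n (p n) × DCRT.Cov (p n) → ℝ)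
    (hmuYHat : ∀ n, Measurable (muYHat n))
    (R : ∀ n, Set (ProbabilityMeasure (DCRT.Obs (p n))))
    (hne : ∀ n, 1 ≤ n → (R n).Nonempty)
    (hvar : ∀ n, 1 ≤ n → ∀ L ∈ R n, DCRT.FiniteCondVar L)
    (hreg : ∀ L : ∀ n, ProbabilityMeasure (DCRT.Obs (p n)), (∀ n, 1 ≤ n → L n ∈ R n) →
      DCRT.Nondegenerate lawHat muYHat L ∧ DCRT.Lyapunov lawHat L ∧
      DCRT.ErrorRates lawHat muYHat L ∧ DCRT.MomentBounds L ∧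
      DCRT.VarianceConsistent lawHat L) :
    limsup (fun n : ℕ => ⨆ L ∈ DCRT.nullLaws (p n) ∩ R n,
      ∫⁻ s, DCRT.test α (lawHat n) (muYHat n) s ∂(DCRT.sampleLaw n L)) atTop
      ≤ ENNReal.ofReal α := by
  suffices h : ∀ ε : ℝ, 0 < ε → limsup (fun n : ℕ => ⨆ L ∈ DCRT.nullLaws (p n) ∩ R n,
      ∫⁻ s, DCRT.test α (lawHat n) (muYHat n) s ∂(DCRT.sampleLaw n L)) atTop
      ≤ ENNReal.ofReal (α + ε) by
    have hlim : Tendsto (fun ε : ℝ => ENNReal.ofReal (α + ε)) (𝓝[>] 0)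
        (𝓝 (ENNReal.ofReal α)) := by
      have : Continuous fun ε : ℝ => ENNReal.ofReal (α + ε) :=
        ENNReal.continuous_ofReal.comp (by fun_prop)
      simpa using (this.tendsto 0).mono_left nhdsWithin_le_nhds
    exact ge_of_tendsto hlim (eventually_nhdsWithin_of_forall h)
  intro ε hε
  -- Reduction to one sequence: at each `n` it picks a null law that is rejected too often whenever
  -- there is one. Where there is none, the law picked need not be null, so the asymptotic level is
  -- only available along the filter of the `n` at which it is.
  let bad : ∀ n, ProbabilityMeasure (DCRT.Obs (p n)) → Prop := fun n M =>
    M ∈ DCRT.nullLaws (p n) ∩ R n ∧ ENNReal.ofReal (α + ε) <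
      ∫⁻ s, DCRT.test α (lawHat n) (muYHat n) s ∂(DCRT.sampleLaw n M)
  have hchoice (n : ℕ) : ∃ M : ProbabilityMeasure (DCRT.Obs (p n)),
      (1 ≤ n → M ∈ R n) ∧ ((∃ M', bad n M') → bad n M) := by
    by_cases hbad : ∃ M', bad n M'
    · obtain ⟨M, hM⟩ := hbad
      exact ⟨M, fun _ => hM.1.2, fun _ => hM⟩
    · rcases Nat.eq_zero_or_pos n with rfl | hn
      · exact ⟨⟨Measure.dirac 0, inferInstance⟩, fun h => absurd h (by norm_num),
          fun h => absurd h hbad⟩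
      · obtain ⟨M, hM⟩ := hne n hn
        exact ⟨M, fun _ => hM, fun h => absurd h hbad⟩
  choose L hLR hLbad using hchoice
  obtain ⟨hndg, hlyap, herr, hmb, hcons⟩ := hreg L hLR
  have hev := DCRT.eventually_lintegral_test_le (L := L)
    (l := atTop ⊓ 𝓟 {n | L n ∈ DCRT.nullLaws (p n)}) hmuYHat inf_le_left
    (mem_inf_of_right (mem_principal_self _))
    (Filter.Eventually.filter_mono inf_le_left ((eventually_ge_atTop 1).mono fun n hn => hvar n hn _ (hLR n hn)))
    hndg hlyap herr hmb hcons hα hε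
  rw [eventually_inf_principal] at hev
  refine limsup_le_of_le (by isBoundedDefault) ?_
  filter_upwards [hev] with n hn
  refine iSup₂_le fun M hM => ?_
  by_contra hlt
  obtain ⟨hL1, hL2⟩ := hLbad n ⟨M, hM, not_le.1 hlt⟩
  exact (hn hL1.1).not_gt hL2
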